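/- Let $p\ge 0$, $n=2p+1$, and let $N$ be a real skew-symmetric $n\times n$ matrix whose $n$ complex eigenvalues are pairwise distinct and whose kernel is one-dimensional. Equip the space $\mathrm{Sym}(n)$ of real symmetric $n\times n$ matrices with the inner product $\mathrm{tr}(XY)$, let $\nabla$ be the corresponding gradient, and let $$\{f,g\}_N(X)=-\mathrm{tr}\bigl[X\bigl(\nabla f(X)\,N\,\nabla g(X)-\nabla g(X)\,N\,\nabla f(X)\bigr)\bigr]$$ be the Lie–Poisson bracket of the Lie algebra $(\mathrm{Sym}(n),\ [X,Y]_N=XNY-YNX)$. Its Poisson tensor is $B_X(Y)=XYN-NYX$, and the Hamiltonian vector field of $h$ is $X\mapsto B_X(\nabla h(X))$. The symplectic leaf through $X$ is the set of points reachable from $X$ along finitely many trajectories of Hamiltonian vector fields of smooth functions; its tangent space at $X$ is the range of $B_X$. For $1\le k\le n-1$ and $0\le 2r<k$ let $h_{k,2r}(X)$ be the coefficient of $\lambda^{2r}$ in $\frac1k\mathrm{tr}(X+\lambda N)^k$. Then the system $\dot X=[X^2,N]$ on $\mathrm{Sym}(n)$ is completely integrable on the generic symplectic leaves, which have dimension $2p(p+1)$,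 by means of the functions $h_{k,2r}$. That is: 1. the system is the Hamiltonian system of $H(X)=\frac12\mathrm{tr}(X^2)$ for $\{\cdot,\cdot\}_N$; 2. the functions $h_{k,2r}$ are smooth, their number is $p(p+1)$, and $\{h_{k,2r},H\}_N=0$ and $\{h_{k,2r},h_{l,2s}\}_N=0$ on $\mathrm{Sym}(n)$ for all admissible indices; 3. there is a proper algebraic subset of $\mathrm{Sym}(n)$ such that, for every $X_0$ outside it, the leaf $L$ through $X_0$ has dimension $2p(p+1)$ (at each of its points), and the differentials of the restrictions $h_{k,2r}|_L$ are linearly independent at all points of an open dense subset of $L$. Moreover, the minimal polynomial of $N$ has the form $s\,w(s^2)$ with $w$ a real polynomial of degree $p$. -/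

import Mathlib

open scoped Matrix ContDiff

attribute [local instance] Matrix.normedAddCommGroup Matrix.normedSpace

noncomputable section

namespace SymFlow

/-- `Sym(n)`, the real vector space of symmetric `n × n` matrices.  It is normed as a subspace of
the matrices with the sup norm of the entries; only the topology and the derivatives are used. -/
def Sym (n : ℕ) : Submodule ℝ (Matrix (Fin n) (Fin n) ℝ) where
  carrier := {X | X.IsSymm}
  add_mem' hX hY := hX.add hY
  zero_mem' := Matrix.isSymm_zero
  smul_mem' c _ hX := hX.smul c

/-- `𝔰𝔬(n)`, the real vector space of skew-symmetric `n × n` matrices. -/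
def So (n : ℕ) : Submodule ℝ (Matrix (Fin n) (Fin n) ℝ) where
  carrier := {N | Nᵀ = -N}
  add_mem' {M N} hM hN := by
    simp only [Set.mem_ofPred_eq] at hM hN ⊢
    rw [Matrix.transpose_add, hM, hN, neg_add]
  zero_mem' := by simp
  smul_mem' c N hN := by
    simp only [Set.mem_ofPred_eq] at hN ⊢
    rw [Matrix.transpose_smul, hN, smul_neg]

variable {n : ℕ}

theorem sym_transpose (X : Sym n) : (X : Matrix (Fin n) (Fin n) ℝ)ᵀ = X := X.2

theorem so_transpose (N : So n) : (N : Matrix (Fin n) (Fin n) ℝ)ᵀ = -N :=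
  N.2

/-- The symmetric matrix `E_ij + E_ji`. -/
def symUnit (i j : Fin n) : Sym n :=
  ⟨Matrix.single i j 1 + Matrix.single j i 1, by
    change Matrix.IsSymm _
    simp [Matrix.IsSymm, Matrix.transpose_add, add_comm]⟩

/-- The gradient of `f : Sym(n) → ℝ` relative to the inner product `tr (X Y)`; it is characterized
by `trace_grad_mul` below. -/
def grad (f : Sym n → ℝ) (X : Sym n) : Sym n :=
  ⟨Matrix.of fun i j => (1 / 2 : ℝ) * fderiv ℝ f X (symUnit i j), by
    change Matrix.IsSymm _
    ext i j
    have h : (symUnit j i : Sym n) = symUnit i j := Subtype.ext (add_comm _ _)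
    simp [Matrix.transpose_apply, h]⟩

theorem sym_eq_sum (Y : Sym n) :
    Y = ∑ i, ∑ j, ((1 / 2 : ℝ) * (Y : Matrix (Fin n) (Fin n) ℝ) i j) • symUnit i j := by
  apply Subtype.ext
  ext a b
  have hs : (Y : Matrix (Fin n) (Fin n) ℝ) b a = (Y : Matrix (Fin n) (Fin n) ℝ) a b :=
    congrFun (congrFun (sym_transpose Y) a) b
  simp only [symUnit, Submodule.coe_sum, Submodule.coe_smul, Matrix.sum_apply, Matrix.smul_apply,
    Matrix.add_apply, Matrix.single_apply, smul_eq_mul, mul_add, Finset.sum_add_distrib, ite_and,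
    mul_ite, mul_one, mul_zero, Finset.sum_ite_eq', Finset.mem_univ, if_true]
  simp [Finset.sum_ite_eq', hs]
  ring

theorem trace_grad_mul (f : Sym n → ℝ) (X Y : Sym n) :
    Matrix.trace ((grad f X : Matrix (Fin n) (Fin n) ℝ) * (Y : Matrix (Fin n) (Fin n) ℝ)) =
      fderiv ℝ f X Y := by
  have hs : ∀ a b, (Y : Matrix (Fin n) (Fin n) ℝ) b a = (Y : Matrix (Fin n) (Fin n) ℝ) a b :=
    fun a b => congrFun (congrFun (sym_transpose Y) a) b
  conv_rhs => rw [sym_eq_sum Y]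
  simp only [map_sum, map_smul, Matrix.trace, Matrix.diag, Matrix.mul_apply, grad, Matrix.of_apply,
    smul_eq_mul]
  refine Finset.sum_congr rfl fun i _ => Finset.sum_congr rfl fun j _ => ?_
  rw [hs i j]
  ring

/-- The Lie-Poisson bracket of `(Sym(n), [X, Y]_N = X N Y - Y N X)`, with `Sym(n)` identified with
its dual through `tr (X Y)`. -/
def liePoisson (N : So n) (f g : Sym n → ℝ) (X : Sym n) : ℝ :=
  -Matrix.trace ((X : Matrix (Fin n) (Fin n) ℝ) *
    ((grad f X : Matrix (Fin n) (Fin n) ℝ) * (N : Matrix (Fin n) (Fin n) ℝ) *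
        (grad g X : Matrix (Fin n) (Fin n) ℝ) -
      (grad g X : Matrix (Fin n) (Fin n) ℝ) * (N : Matrix (Fin n) (Fin n) ℝ) *
        (grad f X : Matrix (Fin n) (Fin n) ℝ)))

/-- The Poisson tensor `B_X(Y) = X Y N - N Y X` of the Lie-Poisson bracket. -/
def poissonTensor (N : So n) (X : Sym n) : Sym n →ₗ[ℝ] Sym n where
  toFun Y := ⟨(X : Matrix (Fin n) (Fin n) ℝ) * (Y : Matrix (Fin n) (Fin n) ℝ) *
        (N : Matrix (Fin n) (Fin n) ℝ) -
      (N : Matrix (Fin n) (Fin n) ℝ) * (Y : Matrix (Fin n) (Fin n) ℝ) *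
        (X : Matrix (Fin n) (Fin n) ℝ), by
    change Matrix.IsSymm _
    simp only [Matrix.IsSymm, Matrix.transpose_sub, Matrix.transpose_mul, sym_transpose,
      so_transpose]
    noncomm_ring⟩
  map_add' Y Z := Subtype.ext (by simp only [Submodule.coe_add]; noncomm_ring)
  map_smul' c Y := Subtype.ext (by simp [smul_sub])

theorem liePoisson_eq (N : So n) (f g : Sym n → ℝ) (X : Sym n) :
    liePoisson N f g X = fderiv ℝ f X (poissonTensor N X (grad g X)) := by
  rw [← trace_grad_mul]
  simp only [liePoisson, poissonTensor, LinearMap.coe_mk, AddHom.coe_mk]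
  generalize (grad f X : Matrix (Fin n) (Fin n) ℝ) = F
  generalize (grad g X : Matrix (Fin n) (Fin n) ℝ) = G
  generalize (X : Matrix (Fin n) (Fin n) ℝ) = X
  generalize (N : Matrix (Fin n) (Fin n) ℝ) = N
  have h1 : Matrix.trace (X * (F * N * G)) = Matrix.trace (F * (N * G * X)) := by
    rw [Matrix.trace_mul_comm]
    simp only [mul_assoc]
  have h2 : Matrix.trace (X * (G * N * F)) = Matrix.trace (F * (X * G * N)) := by
    rw [Matrix.trace_mul_comm F]
    simp only [mul_assoc]
  rw [mul_sub, mul_sub, Matrix.trace_sub, Matrix.trace_sub, h1, h2]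
  ring

/-- The Hamiltonian vector field of `h`, i.e. the one with `X_h[f] = {f, h}_N`
(see `liePoisson_eq`). -/
def hamiltonianField (N : So n) (h : Sym n → ℝ) (X : Sym n) : Sym n :=
  poissonTensor N X (grad h X)

/-- `Z` is the endpoint, at time one, of a trajectory starting at `X` of the Hamiltonian vector
field of some smooth function. -/
def HamiltonianStep (N : So n) (X Z : Sym n) : Prop :=
  ∃ f : Sym n → ℝ, ContDiff ℝ ∞ f ∧ ∃ γ : ℝ → Sym n, γ 0 = X ∧ γ 1 = Z ∧
    ∀ t ∈ Set.Icc (0 : ℝ) 1, HasDerivAt γ (hamiltonianField N f (γ t)) t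

/-- The symplectic leaf of the Lie-Poisson structure through `X`: the points that can be reached
from `X` along finitely many trajectories of Hamiltonian vector fields. -/
def leaf (N : So n) (X : Sym n) : Set (Sym n) :=
  {Z | Relation.ReflTransGen (HamiltonianStep N) X Z}

/-- The tangent space at `X` of the symplectic leaf through `X`: the values at `X` of the
Hamiltonian vector fields. -/
def leafTangent (N : So n) (X : Sym n) : Submodule ℝ (Sym n) :=
  LinearMap.range (poissonTensor N X)

/-- The restrictions to the symplectic leaf through `X` of the functions `F i` have linearly
independent differentials at `X`. -/
def IndependentOnLeafAt (N : So n) {ι : Type*} (F : ι → Sym n → ℝ) (X : Sym n) : Prop :=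
  LinearIndependent ℝ fun i : ι =>
    ((fderiv ℝ (F i) X : Sym n →L[ℝ] ℝ) : Sym n →ₗ[ℝ] ℝ).comp (leafTangent N X).subtype

/-- `P` holds for generic `X` in `Sym(n)`: it holds off a proper algebraic subset. -/
def Generically (P : Sym n → Prop) : Prop :=
  ∃ q : MvPolynomial (Fin n × Fin n) ℝ,
    (∃ X : Sym n, q.eval (fun ij => (X : Matrix (Fin n) (Fin n) ℝ) ij.1 ij.2) ≠ 0) ∧
    ∀ X : Sym n, q.eval (fun ij => (X : Matrix (Fin n) (Fin n) ℝ) ij.1 ij.2) ≠ 0 → P X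

/-- The differential equation `Ẋ = v(X)` on `Sym(n)` is Hamiltonian for the Lie-Poisson bracket
with Hamiltonian `H`, and it is completely integrable, by means of the finite family of integrals
`F`, on the generic symplectic leaves, which have dimension `d`. -/
structure IsCompletelyIntegrable (N : So n) (v : Sym n → Sym n) (H : Sym n → ℝ)
    {ι : Type*} [Fintype ι] (F : ι → Sym n → ℝ) (d : ℕ) : Prop where
  smooth_hamiltonian : ContDiff ℝ ∞ H
  hamiltonian : ∀ X, v X = hamiltonianField N H X
  smooth : ∀ i, ContDiff ℝ ∞ (F i)
  conserved : ∀ i X, liePoisson N (F i) H X = 0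
  involution : ∀ i j X, liePoisson N (F i) (F j) X = 0
  /-- The number of integrals is half the dimension of the generic leaf. -/
  card : 2 * Fintype.card ι = d
  /-- Every leaf `L` through a generic point has dimension `d`, and the restrictions of the
  integrals to `L` are independent on an open dense subset of `L`. -/
  generic_leaf : Generically fun X₀ : Sym n =>
    (∀ X ∈ leaf N X₀, Module.finrank ℝ (leafTangent N X) = d) ∧
    ∃ V : Set (Sym n), IsOpen V ∧ leaf N X₀ ⊆ closure (leaf N X₀ ∩ V) ∧
      ∀ X ∈ leaf N X₀ ∩ V, IndependentOnLeafAt N F X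

/-- The vector field `[X², N]` on `Sym(n)`. -/
def flowField (N : So n) (X : Sym n) : Sym n :=
  ⟨⁅(X : Matrix (Fin n) (Fin n) ℝ) ^ 2, (N : Matrix (Fin n) (Fin n) ℝ)⁆, by
    change Matrix.IsSymm _
    simp only [Ring.lie_def, pow_two, Matrix.IsSymm, Matrix.transpose_sub, Matrix.transpose_mul,
      sym_transpose, so_transpose]
    noncomm_ring⟩

/-- The Hamiltonian `½ tr X²`. -/
def energy (X : Sym n) : ℝ := (1 / 2) * Matrix.trace ((X : Matrix (Fin n) (Fin n) ℝ) ^ 2)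

/-- The coefficient of `λ ^ s` in `(1/k) tr (X + λ N) ^ k`. -/
def integral (N : So n) (k s : ℕ) (X : Sym n) : ℝ :=
  (1 / (k : ℝ)) * (Matrix.trace (((X : Matrix (Fin n) (Fin n) ℝ).map Polynomial.C +
    (Polynomial.X : Polynomial ℝ) •
      (N : Matrix (Fin n) (Fin n) ℝ).map Polynomial.C) ^ k)).coeff s

/-- The pairs `(k, r)` with `1 ≤ k ≤ n - 1` and `0 ≤ 2 r < k`. -/
def integralIndex (n : ℕ) : Finset (ℕ × ℕ) :=
  (Finset.range n ×ˢ Finset.range n).filter fun kr => 1 ≤ kr.1 ∧ 2 * kr.2 < kr.1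

end SymFlow

end

noncomputable section

namespace SymFlow

/-! Write `P_{k,s}` for the coefficient of `λ^s` in `(X + λN)^k`. For even `s` it is symmetric, and
it is the gradient of the coefficient of `λ^s` in `tr (X + λN)^(k+1) / (k+1)`. Since `(X + λN)^k`
commutes with `X + λN`, the Hamiltonian field of `h_{k,2r}` is `[P_{k,2r}, N]`, and `[P_{k,s+1}, X]
= -[P_{k,s}, N]`. This recursion shifts the indices in `tr (P_{a,s} [P_{b,t}, N])` until it reaches
`[P_{b,0}, X] = 0`, which gives involution (`trace_pencilCoeff_involution`); `H = h_{2,0}` is a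
special case.

Every `det (X + cN)` is a Casimir, so along a leaf with `det X ≠ 0` the characteristic polynomial of
`adj X N` is constant. If its roots are distinct, `B_X(Y) = 0` means that `Y X` is a polynomial in
`adj X N`, and symmetry of `Y` leaves only the even powers. The kernel thus has dimension `p + 1` on
the whole leaf (`ker_poissonTensor`).

If a combination of the `dh_{k,2r}` vanishes on the leaf, the same combination of the `P_{k,2r}`
commutes with `N`, hence is a polynomial in `N`, that is, a combination of the `P_{j,j}`. So
independence on the leaf follows from linear independence of all `P_{k,s}` with `s ≤ k < n`
(`independentOnLeafAt_integral`). That is a polynomial condition on `X`, and one complex witness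
suffices: in an eigenbasis of `N` a suitable symmetric `X` becomes a weighted shift, so `P_{k,s}`
sits on the superdiagonal `k - s` and a computation with bidiagonal matrices finishes
(`exists_complex_point`).

The independent points are dense in the leaf because the polynomials vanishing on an open piece of
it form an ideal stable under the linear Hamiltonian fields. Noetherianity and Gronwall's inequality
carry this vanishing along every Hamiltonian trajectory, back to the generic point `X₀`
(`leaf_subset_closure`). -/

open Polynomial in
/-- The matrix pencil `X + λ N`, as a matrix of polynomials in `λ`. -/
def pencil {n : ℕ} {R : Type*} [CommRing R] (X N : Matrix (Fin n) (Fin n) R) :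
    Matrix (Fin n) (Fin n) R[X] :=
  X.map Polynomial.C + (Polynomial.X : R[X]) • N.map Polynomial.C

/-- The coefficient of `λ ^ s` in `(X + λ N) ^ k`. -/
def pencilCoeff {n : ℕ} {R : Type*} [CommRing R] (X N : Matrix (Fin n) (Fin n) R) (k s : ℕ) :
    Matrix (Fin n) (Fin n) R :=
  (pencil X N ^ k).map fun f => f.coeff s

/-! ### Algebra of the coefficients of powers of the pencil. -/

section PencilAlgebra

variable {n : ℕ} {R S : Type*} [CommRing R] [CommRing S] (X N : Matrix (Fin n) (Fin n) R)

theorem pencil_apply (i j : Fin n) :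
    pencil X N i j = Polynomial.C (X i j) + Polynomial.X * Polynomial.C (N i j) := by
  simp [pencil]

theorem pencilCoeff_zero (s : ℕ) : pencilCoeff X N 0 s = if s = 0 then 1 else 0 := by
  ext i j
  by_cases hs : s = 0 <;> by_cases hij : i = j <;>
    simp [pencilCoeff, Matrix.one_apply, Polynomial.coeff_one, hs, hij]

theorem pencilCoeff_succ_zero (k : ℕ) :
    pencilCoeff X N (k + 1) 0 = pencilCoeff X N k 0 * X := by
  ext i j
  simp [pencilCoeff, pow_succ, Matrix.mul_apply, pencil_apply, Polynomial.finsetSum_coeff,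
    mul_add, Polynomial.mul_coeff_zero]

theorem pencilCoeff_succ_zero' (k : ℕ) :
    pencilCoeff X N (k + 1) 0 = X * pencilCoeff X N k 0 := by
  ext i j
  simp [pencilCoeff, pow_succ', Matrix.mul_apply, pencil_apply, Polynomial.finsetSum_coeff,
    add_mul, Polynomial.mul_coeff_zero]

theorem pencilCoeff_succ_succ (k s : ℕ) :
    pencilCoeff X N (k + 1) (s + 1) = pencilCoeff X N k (s + 1) * X + pencilCoeff X N k s * N := by
  ext i j
  simp [pencilCoeff, pow_succ, Matrix.mul_apply, pencil_apply, Polynomial.finsetSum_coeff,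
    mul_add, ← mul_assoc, Polynomial.coeff_mul_X, Finset.sum_add_distrib]

theorem pencilCoeff_succ_succ' (k s : ℕ) :
    pencilCoeff X N (k + 1) (s + 1) = X * pencilCoeff X N k (s + 1) + N * pencilCoeff X N k s := by
  ext i j
  simp [pencilCoeff, pow_succ', Matrix.mul_apply, pencil_apply, Polynomial.finsetSum_coeff,
    add_mul, mul_assoc, Polynomial.coeff_X_mul, Finset.sum_add_distrib]

theorem pencilCoeff_eq_zero {k s : ℕ} (h : k < s) : pencilCoeff X N k s = 0 := by
  induction k generalizing s with
  | zero => rw [pencilCoeff_zero, if_neg (by omega)]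
  | succ k ih =>
    obtain ⟨s, rfl⟩ : ∃ t, s = t + 1 := ⟨s - 1, by omega⟩
    rw [pencilCoeff_succ_succ, ih (by omega), ih (by omega), zero_mul, zero_mul, add_zero]

theorem pencilCoeff_self (k : ℕ) : pencilCoeff X N k k = N ^ k := by
  induction k with
  | zero => simp [pencilCoeff_zero]
  | succ k ih =>
    rw [pencilCoeff_succ_succ, pencilCoeff_eq_zero X N (Nat.lt_succ_self k), ih, zero_mul, zero_add,
      pow_succ]

theorem pencilCoeff_map (f : R →+* S) (k s : ℕ) :
    pencilCoeff (X.map f) (N.map f) k s = (pencilCoeff X N k s).map f := by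
  induction k generalizing s with
  | zero =>
    by_cases hs : s = 0 <;> simp [pencilCoeff_zero, hs]
  | succ k ih =>
    cases s with
    | zero => rw [pencilCoeff_succ_zero, pencilCoeff_succ_zero, ih, Matrix.map_mul]
    | succ s =>
      rw [pencilCoeff_succ_succ, pencilCoeff_succ_succ, ih, ih, ← Matrix.map_mul, ← Matrix.map_mul,
        Matrix.map_add _ (map_add f)]

theorem pencilCoeff_conj {P Q : Matrix (Fin n) (Fin n) R} (h : P * Q = 1) (k s : ℕ) :
    pencilCoeff (Q * X * P) (Q * N * P) k s = Q * pencilCoeff X N k s * P := by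
  have h' : Q * P = 1 := mul_eq_one_comm.1 h
  have key : ∀ A B : Matrix (Fin n) (Fin n) R, Q * A * P * (Q * B * P) = Q * (A * B) * P := by
    intro A B
    calc Q * A * P * (Q * B * P) = Q * A * (P * Q) * B * P := by simp only [mul_assoc]
      _ = _ := by rw [h, mul_one]; simp only [mul_assoc]
  induction k generalizing s with
  | zero =>
    by_cases hs : s = 0 <;> simp [pencilCoeff_zero, hs, h']
  | succ k ih =>
    cases s with
    | zero => rw [pencilCoeff_succ_zero, pencilCoeff_succ_zero, ih, key]
    | succ s =>
      rw [pencilCoeff_succ_succ, pencilCoeff_succ_succ, ih, ih, key, key, mul_add, add_mul]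

/-- Transposition reverses each word in `X` and `N` and contributes one sign per letter `N`; the set
of words with `s` letters `N` is invariant under reversal. -/
theorem pencilCoeff_transpose (hX : Xᵀ = X) (hN : Nᵀ = -N) (k s : ℕ) :
    (pencilCoeff X N k s)ᵀ = (-1) ^ s * pencilCoeff X N k s := by
  induction k generalizing s with
  | zero =>
    by_cases hs : s = 0 <;> simp [pencilCoeff_zero, hs]
  | succ k ih =>
    cases s with
    | zero =>
      rw [pencilCoeff_succ_zero, Matrix.transpose_mul, ih, hX, ← pencilCoeff_succ_zero,
        pencilCoeff_succ_zero']
      simp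
    | succ s =>
      rw [pencilCoeff_succ_succ, Matrix.transpose_add, Matrix.transpose_mul, Matrix.transpose_mul,
        ih, ih, hX, hN, ← pencilCoeff_succ_succ, pencilCoeff_succ_succ', pow_succ]
      rcases neg_one_pow_eq_or (Matrix (Fin n) (Fin n) R) s with h | h <;> rw [h] <;> noncomm_ring

/-- Peel a factor of `P_{k+1,s}` off on the left in the first term and on the right in the second:
the two terms `N P_{k,s-1} N` cancel. -/
theorem pencilCoeff_poisson (k s : ℕ) :
    X * pencilCoeff X N k s * N - N * pencilCoeff X N k s * X =
      pencilCoeff X N (k + 1) s * N - N * pencilCoeff X N (k + 1) s := by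
  cases s with
  | zero =>
    conv_rhs => rw [pencilCoeff_succ_zero']
    rw [← pencilCoeff_succ_zero' , pencilCoeff_succ_zero, mul_assoc N]
  | succ s =>
    conv_rhs =>
      enter [1]
      rw [pencilCoeff_succ_succ']
    rw [pencilCoeff_succ_succ]
    noncomm_ring

theorem pencilCoeff_commute_zero (k : ℕ) :
    pencilCoeff X N k 0 * X - X * pencilCoeff X N k 0 = 0 := by
  rw [← pencilCoeff_succ_zero, ← pencilCoeff_succ_zero', sub_self]

theorem pencilCoeff_commute_succ (k s : ℕ) :
    pencilCoeff X N k (s + 1) * X - X * pencilCoeff X N k (s + 1) =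
      -(pencilCoeff X N k s * N - N * pencilCoeff X N k s) := by
  have := (pencilCoeff_succ_succ X N k s).symm.trans (pencilCoeff_succ_succ' X N k s)
  rw [neg_sub, sub_eq_sub_iff_add_eq_add, this, add_comm]

theorem trace_mul_commutator (A B C : Matrix (Fin n) (Fin n) R) :
    (A * (B * C - C * B)).trace = -(B * (A * C - C * A)).trace := by
  rw [mul_sub, mul_sub, Matrix.trace_sub, Matrix.trace_sub, neg_sub]
  congr 1
  · rw [Matrix.trace_mul_comm, mul_assoc]
  · rw [← mul_assoc, ← mul_assoc, Matrix.trace_mul_comm, ← mul_assoc]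

/-- Invariance of the trace moves the commutator with `N` onto `P_{a,s}`, where the recursion turns
it into one with `X`; applying the recursion to `P_{b,t}` then replaces `(s, t)` by `(s + 1, t -
1)`. The descent ends because `P_{b,0}` is a power of `X`. -/
theorem trace_pencilCoeff_involution (a b s t : ℕ) :
    (pencilCoeff X N a s * (pencilCoeff X N b t * N - N * pencilCoeff X N b t)).trace = 0 := by
  have key : ∀ b s t, (pencilCoeff X N a s *
      (pencilCoeff X N b t * N - N * pencilCoeff X N b t)).trace =
      -(pencilCoeff X N a (s + 1) *
        (pencilCoeff X N b t * X - X * pencilCoeff X N b t)).trace := by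
    intro b s t
    rw [trace_mul_commutator, ← Matrix.trace_neg, ← mul_neg, ← pencilCoeff_commute_succ,
      trace_mul_commutator]
  induction t generalizing s with
  | zero => rw [key, pencilCoeff_commute_zero, mul_zero, Matrix.trace_zero, neg_zero]
  | succ t ih => rw [key, pencilCoeff_commute_succ, mul_neg, Matrix.trace_neg, ih, neg_zero, neg_zero]

theorem sum_pencilCoeff (c : R) (k : ℕ) :
    (X + c • N) ^ k = ∑ s ∈ Finset.range (k + 1), c ^ s • pencilCoeff X N k s := by
  have h : (X + c • N) ^ k = (pencil X N ^ k).map (Polynomial.evalRingHom c) := by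
    rw [← RingHom.mapMatrix_apply, map_pow]
    congr 1
    ext i j
    simp [pencil_apply, mul_comm c]
  have hdeg : ∀ i j, ((pencil X N ^ k) i j).natDegree < k + 1 := by
    intro i j
    refine Nat.lt_succ_of_le (Polynomial.natDegree_le_iff_coeff_eq_zero.2 fun s hs => ?_)
    exact congrFun (congrFun (pencilCoeff_eq_zero X N hs) i) j
  rw [h]
  ext i j
  simp only [Matrix.map_apply, Polynomial.coe_evalRingHom, Matrix.sum_apply, Matrix.smul_apply,
    smul_eq_mul]
  rw [Polynomial.eval_eq_sum_range' (hdeg i j)]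
  exact Finset.sum_congr rfl fun s _ => mul_comm _ _

end PencilAlgebra

theorem integral_eq {n : ℕ} (N : So n) (k s : ℕ) (X : Sym n) :
    integral N k s X = (1 / (k : ℝ)) * (pencilCoeff (X : Matrix (Fin n) (Fin n) ℝ) N k s).trace := by
  simp [integral, pencilCoeff, pencil, Matrix.trace, Polynomial.finsetSum_coeff]

/-! ### Derivatives, gradients and involution of the integrals. -/

section Calculus

variable {n : ℕ}

theorem hasDerivAt_matrix {M : ℝ → Matrix (Fin n) (Fin n) ℝ} {M' : Matrix (Fin n) (Fin n) ℝ}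
    {t : ℝ} : HasDerivAt M M' t ↔ ∀ i j, HasDerivAt (fun x => M x i j) (M' i j) t := by
  exact (hasDerivAt_pi (φ := fun x i => M x i)).trans
    (forall_congr' fun i => hasDerivAt_pi (φ := fun x j => M x i j))

theorem hasDerivAt_matrix_mul {A B : ℝ → Matrix (Fin n) (Fin n) ℝ}
    {A' B' : Matrix (Fin n) (Fin n) ℝ} {t : ℝ} (hA : HasDerivAt A A' t) (hB : HasDerivAt B B' t) :
    HasDerivAt (fun x => A x * B x) (A' * B t + A t * B') t := by
  rw [hasDerivAt_matrix] at *
  intro i j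
  simp only [Matrix.add_apply, Matrix.mul_apply, ← Finset.sum_add_distrib]
  exact HasDerivAt.fun_sum fun l _ => (hA i l).mul (hB l j)

theorem hasDerivAt_matrix_trace {A : ℝ → Matrix (Fin n) (Fin n) ℝ}
    {A' : Matrix (Fin n) (Fin n) ℝ} {t : ℝ} (hA : HasDerivAt A A' t) :
    HasDerivAt (fun x => (A x).trace) A'.trace t := by
  rw [hasDerivAt_matrix] at hA
  exact HasDerivAt.fun_sum fun i _ => hA i i

/-- The derivative of a power has no closed form when `M` and `M'` do not commute, but its trace
against a matrix commuting with `M t` does. The test matrix `C` makes the induction close: the step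
replaces it by `C * M t`. -/
theorem exists_hasDerivAt_matrix_pow {M : ℝ → Matrix (Fin n) (Fin n) ℝ}
    {M' : Matrix (Fin n) (Fin n) ℝ} {t : ℝ} (hM : HasDerivAt M M' t) (k : ℕ) :
    ∃ D, HasDerivAt (fun x => M x ^ (k + 1)) D t ∧ ∀ C, Commute C (M t) →
      (C * D).trace = (k + 1) * (C * M t ^ k * M').trace := by
  induction k with
  | zero => exact ⟨M', by simpa using hM, fun C _ => by simp⟩
  | succ k ih =>
    obtain ⟨D, hD, h⟩ := ih
    refine ⟨D * M t + M t ^ (k + 1) * M', ?_, fun C hC => ?_⟩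
    · simpa only [pow_succ _ (k + 1)] using hasDerivAt_matrix_mul hD hM
    · have h1 : (C * (D * M t)).trace = (C * M t * D).trace := by
        rw [← mul_assoc, Matrix.trace_mul_comm, ← mul_assoc, hC.eq]
      rw [mul_add, Matrix.trace_add, h1, h _ (hC.mul_left (Commute.refl _)), mul_assoc C (M t),
        ← pow_succ', ← mul_assoc]
      push_cast
      ring

theorem hasDerivAt_trace_pow {M : ℝ → Matrix (Fin n) (Fin n) ℝ}
    {M' : Matrix (Fin n) (Fin n) ℝ} {t : ℝ} (hM : HasDerivAt M M' t) (k : ℕ) :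
    HasDerivAt (fun x => (M x ^ (k + 1)).trace) ((k + 1) * (M t ^ k * M').trace) t := by
  obtain ⟨D, hD, h⟩ := exists_hasDerivAt_matrix_pow hM k
  have := h 1 (Commute.one_left _)
  rw [one_mul, one_mul] at this
  rw [← this]
  exact hasDerivAt_matrix_trace hD

/-- Jacobi's formula; Cramer's rule identifies the diagonal entries of `adj M * M'` with
determinants in which one column is differentiated. -/
theorem hasDerivAt_det {M : ℝ → Matrix (Fin n) (Fin n) ℝ}
    {M' : Matrix (Fin n) (Fin n) ℝ} {t : ℝ} (hM : HasDerivAt M M' t) :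
    HasDerivAt (fun x => (M x).det) ((M t).adjugate * M').trace t := by
  rw [hasDerivAt_matrix] at hM
  have h : ((M t).adjugate * M').trace =
      ∑ σ : Equiv.Perm (Fin n), ((Equiv.Perm.sign σ : ℤ) : ℝ) *
        ∑ i, (∏ j ∈ Finset.univ.erase i, M t (σ j) j) * M' (σ i) i := by
    have h1 : ∀ i, ((M t).adjugate * M') i i = ((M t).updateCol i fun j => M' j i).det := by
      intro i
      rw [← Matrix.cramer_apply, Matrix.cramer_eq_adjugate_mulVec]
      rfl
    simp only [Matrix.trace, Matrix.diag, h1, Matrix.det_apply', Finset.mul_sum]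
    rw [Finset.sum_comm]
    refine Finset.sum_congr rfl fun σ _ => Finset.sum_congr rfl fun i _ => ?_
    congr 1
    rw [← Finset.mul_prod_erase _ _ (Finset.mem_univ i), mul_comm]
    congr 1
    · exact Finset.prod_congr rfl fun j hj => by
        rw [Matrix.updateCol_ne (Finset.ne_of_mem_erase hj)]
    · rw [Matrix.updateCol_self]
  rw [h]
  simp only [Matrix.det_apply']
  refine HasDerivAt.fun_sum fun σ _ => HasDerivAt.const_mul _ ?_
  simpa only [smul_eq_mul] using HasDerivAt.fun_finsetProd fun i _ => hM (σ i) i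

/-- The inclusion of `Sym(n)` into the matrices as a continuous linear map. -/
def symVal (n : ℕ) : Sym n →L[ℝ] Matrix (Fin n) (Fin n) ℝ := (Sym n).subtypeL

theorem hasDerivAt_symVal {γ : ℝ → Sym n} {γ' : Sym n} {t : ℝ} (h : HasDerivAt γ γ' t) :
    HasDerivAt (fun x => (γ x : Matrix (Fin n) (Fin n) ℝ)) γ' t :=
  (symVal n).hasFDerivAt.comp_hasDerivAt t h

/-- The entries of a matrix, as an argument for polynomials in the entries. -/
def entries {R : Type*} (X : Matrix (Fin n) (Fin n) R) : Fin n × Fin n → R := fun ij => X ij.1 ij.2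

theorem hasDerivAt_eval (q : MvPolynomial (Fin n × Fin n) ℝ) {M : ℝ → Matrix (Fin n) (Fin n) ℝ}
    {M' : Matrix (Fin n) (Fin n) ℝ} {t : ℝ} (hM : HasDerivAt M M' t) :
    HasDerivAt (fun x => MvPolynomial.eval (entries (M x)) q)
      (∑ ij, MvPolynomial.eval (entries (M t)) (MvPolynomial.pderiv ij q) * M' ij.1 ij.2) t := by
  rw [hasDerivAt_matrix] at hM
  induction q using MvPolynomial.induction_on with
  | C a => simpa using hasDerivAt_const t a
  | add p q hp hq =>
    simpa only [map_add, add_mul, Finset.sum_add_distrib] using hp.fun_add hq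
  | mul_X p ij hp =>
    have h := hp.fun_mul (hM ij.1 ij.2)
    simp only [map_mul, MvPolynomial.eval_X, Derivation.leibniz, MvPolynomial.pderiv_X, smul_eq_mul,
      map_add, add_mul, Finset.sum_add_distrib]
    refine h.congr_deriv ?_
    rw [add_comm, Finset.sum_mul]
    congr 1
    · rw [Finset.sum_eq_single ij]
      · rw [Pi.single_eq_same, map_one, mul_one]
      · intro kl _ hkl
        rw [Pi.single_eq_of_ne hkl.symm, map_zero, mul_zero, zero_mul]
      · exact fun h => absurd (Finset.mem_univ ij) h
    · exact Finset.sum_congr rfl fun _ _ => by simp only [entries]; ring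

theorem contDiff_eval (q : MvPolynomial (Fin n × Fin n) ℝ) :
    ContDiff ℝ ∞ fun X : Sym n => MvPolynomial.eval (entries (X : Matrix (Fin n) (Fin n) ℝ)) q := by
  induction q using MvPolynomial.induction_on with
  | C a => simpa using contDiff_const
  | add p q hp hq => simpa using hp.add hq
  | mul_X p ij hp =>
    have h : ContDiff ℝ ∞ fun X : Sym n => (X : Matrix (Fin n) (Fin n) ℝ) ij.1 ij.2 :=
      contDiff_pi.1 (contDiff_pi.1 (symVal n).contDiff ij.1) ij.2
    simpa [entries] using hp.mul h

/-- The polynomials in the entries of `X` that are the entries of `pencilCoeff X N k s`. -/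
def pencilPoly {R : Type*} [CommRing R] (N : Matrix (Fin n) (Fin n) R) (k s : ℕ) :
    Matrix (Fin n) (Fin n) (MvPolynomial (Fin n × Fin n) R) :=
  pencilCoeff (Matrix.mvPolynomialX (Fin n) (Fin n) R) (N.map MvPolynomial.C) k s

theorem map_eval_mvPolynomialX {R : Type*} [CommRing R] (X : Matrix (Fin n) (Fin n) R) :
    (Matrix.mvPolynomialX (Fin n) (Fin n) R).map (MvPolynomial.eval (entries X)) = X := by
  ext i j
  simp [Matrix.mvPolynomialX, entries]

theorem map_eval_map_C {R : Type*} [CommRing R] (X N : Matrix (Fin n) (Fin n) R) :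
    (N.map MvPolynomial.C).map (MvPolynomial.eval (entries X)) = N := by
  ext i j
  simp

theorem pencilPoly_map_eval {R : Type*} [CommRing R] (X N : Matrix (Fin n) (Fin n) R) (k s : ℕ) :
    (pencilPoly N k s).map (MvPolynomial.eval (entries X)) = pencilCoeff X N k s := by
  rw [pencilPoly, ← pencilCoeff_map, map_eval_mvPolynomialX, map_eval_map_C]

theorem contDiff_integral (N : So n) (k s : ℕ) : ContDiff ℝ ∞ (integral N k s) := by
  have h : integral N k s = fun X : Sym n => (1 / (k : ℝ)) *
      MvPolynomial.eval (entries (X : Matrix (Fin n) (Fin n) ℝ))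
        (pencilPoly (N : Matrix (Fin n) (Fin n) ℝ) k s).trace := by
    funext X
    rw [integral_eq, ← pencilPoly_map_eval, ← AddMonoidHom.map_trace]
  rw [h]
  exact contDiff_const.mul (contDiff_eval _)

theorem hasDerivAt_line (X Y : Sym n) (t : ℝ) : HasDerivAt (fun t : ℝ => X + t • Y) Y t := by
  have h := ((hasDerivAt_id t).smul_const Y).const_add X
  rw [one_smul] at h
  exact h

theorem fderiv_integral (N : So n) (k s : ℕ) (X Y : Sym n) :
    fderiv ℝ (integral N (k + 1) s) X Y =
      (pencilCoeff (X : Matrix (Fin n) (Fin n) ℝ) N k s * Y).trace := by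
  have hline : ∀ s, HasDerivAt (fun t : ℝ => integral N (k + 1) s (X + t • Y))
      (fderiv ℝ (integral N (k + 1) s) X Y) 0 := by
    intro s
    have h0 : X = X + (0 : ℝ) • Y := by simp
    have h := ((contDiff_integral N (k + 1) s).differentiable (by simp)
      (X + (0 : ℝ) • Y)).hasFDerivAt.comp_hasDerivAt (0 : ℝ) (hasDerivAt_line X Y 0)
    rw [← h0] at h
    exact h
  have hk : ((k : ℝ) + 1) ≠ 0 := by positivity
  -- Differentiate `tr (X + cN)^(k+1) / (k+1)` in the direction `Y` for every fixed `c`; comparing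
  -- powers of `c` then isolates each coefficient.
  have key : ∀ c : ℝ, ∑ s ∈ Finset.range (k + 2), c ^ s * fderiv ℝ (integral N (k + 1) s) X Y =
      ∑ s ∈ Finset.range (k + 1),
        c ^ s * (pencilCoeff (X : Matrix (Fin n) (Fin n) ℝ) N k s * Y).trace := by
    intro c
    have h1 : HasDerivAt (fun t : ℝ => ∑ s ∈ Finset.range (k + 2),
        c ^ s * integral N (k + 1) s (X + t • Y)) (∑ s ∈ Finset.range (k + 2),
        c ^ s * fderiv ℝ (integral N (k + 1) s) X Y) 0 :=
      HasDerivAt.fun_sum fun s _ => (hline s).const_mul _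
    have h2 := (hasDerivAt_trace_pow (k := k) ((hasDerivAt_symVal (hasDerivAt_line X Y 0)).add_const
      (c • (N : Matrix (Fin n) (Fin n) ℝ)))).const_mul (1 / ((k : ℝ) + 1))
    have h3 : (fun t : ℝ => ∑ s ∈ Finset.range (k + 2),
        c ^ s * integral N (k + 1) s (X + t • Y)) = fun t : ℝ => 1 / ((k : ℝ) + 1) *
        ((((X + t • Y : Sym n) : Matrix (Fin n) (Fin n) ℝ) +
          c • (N : Matrix (Fin n) (Fin n) ℝ)) ^ (k + 1)).trace := by
      funext t
      rw [sum_pencilCoeff, Matrix.trace_sum, Finset.mul_sum]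
      refine Finset.sum_congr rfl fun s _ => ?_
      rw [integral_eq, Matrix.trace_smul, smul_eq_mul]
      push_cast
      ring
    rw [h3] at h1
    rw [h1.unique h2, ← mul_assoc, one_div, inv_mul_cancel₀ hk, one_mul]
    simp only [zero_smul, add_zero]
    rw [sum_pencilCoeff, Finset.sum_mul, Matrix.trace_sum]
    refine Finset.sum_congr rfl fun s _ => ?_
    rw [Matrix.smul_mul, Matrix.trace_smul, smul_eq_mul]
  have hpoly : (∑ s ∈ Finset.range (k + 2),
      Polynomial.monomial s (fderiv ℝ (integral N (k + 1) s) X Y)) =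
      ∑ s ∈ Finset.range (k + 1), Polynomial.monomial s
        (pencilCoeff (X : Matrix (Fin n) (Fin n) ℝ) N k s * Y).trace := by
    refine Polynomial.funext fun c => ?_
    simpa [Polynomial.eval_finsetSum, mul_comm] using key c
  have hc := congrArg (fun f => Polynomial.coeff f s) hpoly
  simp only [Polynomial.finsetSum_coeff, Polynomial.coeff_monomial, Finset.sum_ite_eq',
    Finset.mem_range] at hc
  by_cases hs : s < k + 1
  · rwa [if_pos (by omega), if_pos hs] at hc
  -- For `s = k + 1` only the left-hand sum has a term, so it must vanish; for larger `s` the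
  -- function itself is zero.
  · rw [pencilCoeff_eq_zero _ _ (by omega), zero_mul, Matrix.trace_zero]
    by_cases hs' : s < k + 2
    · rwa [if_pos hs', if_neg hs] at hc
    · have h0 : integral N (k + 1) s = fun _ => 0 := by
        funext X
        rw [integral_eq, pencilCoeff_eq_zero _ _ (by omega), Matrix.trace_zero, mul_zero]
      simp [h0]

theorem pencilCoeff_isSymm (N : So n) (X : Sym n) (k r : ℕ) :
    (pencilCoeff (X : Matrix (Fin n) (Fin n) ℝ) N k (2 * r)).IsSymm := by
  rw [Matrix.IsSymm, pencilCoeff_transpose _ _ (sym_transpose X) (so_transpose N)]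
  simp

theorem eq_zero_of_trace_mul (Z : Sym n)
    (h : ∀ Y : Sym n, ((Z : Matrix (Fin n) (Fin n) ℝ) * Y).trace = 0) : Z = 0 := by
  have hZ := h Z
  have : ((Z : Matrix (Fin n) (Fin n) ℝ)ᴴ * Z).trace = 0 := by
    rwa [Matrix.conjTranspose_eq_transpose_of_trivial, sym_transpose]
  exact Subtype.ext (Matrix.trace_conjTranspose_mul_self_eq_zero_iff.1 this)

theorem grad_integral (N : So n) (k r : ℕ) (X : Sym n) :
    (grad (integral N (k + 1) (2 * r)) X : Matrix (Fin n) (Fin n) ℝ) =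
      pencilCoeff (X : Matrix (Fin n) (Fin n) ℝ) N k (2 * r) := by
  have h := eq_zero_of_trace_mul (grad (integral N (k + 1) (2 * r)) X -
    ⟨_, pencilCoeff_isSymm N X k r⟩) fun Y => by
      rw [Submodule.coe_sub, sub_mul, Matrix.trace_sub, trace_grad_mul, fderiv_integral, sub_self]
  exact congrArg Subtype.val (sub_eq_zero.1 h)

theorem poissonTensor_grad_integral (N : So n) (k r : ℕ) (X : Sym n) :
    (poissonTensor N X (grad (integral N (k + 1) (2 * r)) X) : Matrix (Fin n) (Fin n) ℝ) =
      pencilCoeff (X : Matrix (Fin n) (Fin n) ℝ) N (k + 1) (2 * r) * N -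
        N * pencilCoeff (X : Matrix (Fin n) (Fin n) ℝ) N (k + 1) (2 * r) := by
  rw [← pencilCoeff_poisson, ← grad_integral]
  rfl

theorem liePoisson_integral (N : So n) (k l r s : ℕ) (X : Sym n) :
    liePoisson N (integral N (k + 1) (2 * r)) (integral N (l + 1) (2 * s)) X = 0 := by
  rw [liePoisson_eq, fderiv_integral, poissonTensor_grad_integral, trace_pencilCoeff_involution]

/-- This makes conservation of the integrals an instance of their involution. -/
theorem energy_eq_integral (N : So n) : energy = integral N 2 (2 * 0) := by
  funext X
  simp [integral_eq, energy, pencilCoeff_succ_zero, pencilCoeff_zero, pow_two]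

theorem flowField_eq (N : So n) (X : Sym n) : flowField N X = hamiltonianField N energy X := by
  apply Subtype.ext
  rw [hamiltonianField, energy_eq_integral N, poissonTensor_grad_integral]
  simp [flowField, Ring.lie_def, pencilCoeff_succ_zero, pencilCoeff_zero, pow_two]

end Calculus

/-! ### Casimirs, and propagation of polynomial identities along a leaf. -/

section Leaf

variable {n : ℕ}

theorem HamiltonianStep.det_add_smul {N : So n} {X Z : Sym n} (h : HamiltonianStep N X Z) (c : ℝ) :
    ((X : Matrix (Fin n) (Fin n) ℝ) + c • (N : Matrix (Fin n) (Fin n) ℝ)).det =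
      ((Z : Matrix (Fin n) (Fin n) ℝ) + c • (N : Matrix (Fin n) (Fin n) ℝ)).det := by
  obtain ⟨f, -, γ, rfl, rfl, hγ⟩ := h
  have key : ∀ t ∈ Set.Icc (0 : ℝ) 1, HasDerivAt (fun t =>
      ((γ t : Matrix (Fin n) (Fin n) ℝ) + c • (N : Matrix (Fin n) (Fin n) ℝ)).det) 0 t := by
    intro t ht
    refine (hasDerivAt_det ((hasDerivAt_symVal (hγ t ht)).add_const _)).congr_deriv ?_
    simp only [hamiltonianField, poissonTensor, LinearMap.coe_mk, AddHom.coe_mk]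
    generalize (grad f (γ t) : Matrix (Fin n) (Fin n) ℝ) = Y
    generalize (N : Matrix (Fin n) (Fin n) ℝ) = N
    generalize (γ t : Matrix (Fin n) (Fin n) ℝ) = X
    -- The added terms `c N Y N` cancel. With `X + cN` as an outer factor, each product with the
    -- adjugate becomes a determinant, and what remains is `tr (Y N) - tr (N Y)`.
    have h1 : X * Y * N - N * Y * X = (X + c • N) * (Y * N) - N * Y * (X + c • N) := by
      simp only [add_mul, mul_add, Matrix.smul_mul, Matrix.mul_smul, mul_assoc]
      abel
    rw [h1, mul_sub, Matrix.trace_sub, ← mul_assoc _ (X + c • N) (Y * N), Matrix.adjugate_mul,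
      ← mul_assoc _ (N * Y) (X + c • N), Matrix.trace_mul_comm _ (X + c • N),
      ← mul_assoc (X + c • N) _ (N * Y),
      Matrix.mul_adjugate, Matrix.smul_mul, Matrix.smul_mul, Matrix.trace_smul, Matrix.trace_smul,
      one_mul, one_mul, Matrix.trace_mul_comm Y N, sub_self]
  exact (constant_of_has_deriv_right_zero
    (fun t ht => (key t ht).continuousAt.continuousWithinAt)
    (fun t ht => (key t (Set.Ico_subset_Icc_self ht)).hasDerivWithinAt) 1
    (Set.right_mem_Icc.2 zero_le_one)).symm

theorem det_add_smul_of_mem_leaf {N : So n} {X Z : Sym n} (h : Z ∈ leaf N X) (c : ℝ) :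
    ((X : Matrix (Fin n) (Fin n) ℝ) + c • (N : Matrix (Fin n) (Fin n) ℝ)).det =
      ((Z : Matrix (Fin n) (Fin n) ℝ) + c • (N : Matrix (Fin n) (Fin n) ℝ)).det := by
  induction h with
  | refl => rfl
  | tail _ h ih => exact ih.trans (h.det_add_smul c)

/-- Multiply `c - adj X N` by `X` on the left: the result is `c X - det X N`. Hence the Casimirs
determine the characteristic polynomial of `adj X N`. -/
theorem det_mul_charpoly_eval (X N : Matrix (Fin n) (Fin n) ℝ) {c : ℝ} (hc : c ≠ 0) :
    X.det * (X.adjugate * N).charpoly.eval c = c ^ n * (X + (-(X.det / c)) • N).det := by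
  rw [Matrix.eval_charpoly, ← Matrix.det_mul, mul_sub, ← mul_assoc, Matrix.mul_adjugate]
  have h := Matrix.det_smul (X + (-(X.det / c)) • N) c
  rw [Fintype.card_fin] at h
  rw [← h]
  congr 1
  rw [smul_add, smul_smul, mul_neg, mul_div_cancel₀ _ hc, neg_smul, ← sub_eq_add_neg,
    Matrix.smul_mul, one_mul, Matrix.scalar_apply, ← Matrix.smul_one_eq_diagonal, Matrix.mul_smul,
    mul_one]

theorem charpoly_eq_of_mem_leaf {N : So n} {X Z : Sym n} (h : Z ∈ leaf N X)
    (hX : (X : Matrix (Fin n) (Fin n) ℝ).det ≠ 0) :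
    (Z : Matrix (Fin n) (Fin n) ℝ).det ≠ 0 ∧
    ((Z : Matrix (Fin n) (Fin n) ℝ).adjugate * (N : Matrix (Fin n) (Fin n) ℝ)).charpoly =
      ((X : Matrix (Fin n) (Fin n) ℝ).adjugate * (N : Matrix (Fin n) (Fin n) ℝ)).charpoly := by
  have hdet : (X : Matrix (Fin n) (Fin n) ℝ).det = (Z : Matrix (Fin n) (Fin n) ℝ).det := by
    simpa using det_add_smul_of_mem_leaf h 0
  -- The extra factor `Polynomial.X` makes the comparison trivial at `c = 0`, where the Casimir
  -- formula is not available.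
  refine ⟨hdet ▸ hX, mul_left_cancel₀ Polynomial.X_ne_zero (Polynomial.funext fun c => ?_)⟩
  rw [Polynomial.eval_mul, Polynomial.eval_mul, Polynomial.eval_X]
  by_cases hc : c = 0
  · rw [hc, zero_mul, zero_mul]
  · congr 1
    refine mul_left_cancel₀ hX ?_
    conv_lhs => rw [hdet]
    rw [det_mul_charpoly_eval _ _ hc, det_mul_charpoly_eval _ _ hc, det_add_smul_of_mem_leaf h, hdet]

theorem grad_neg (f : Sym n → ℝ) (X : Sym n) : grad (fun Z => -f Z) X = -grad f X := by
  apply Subtype.ext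
  have h : fderiv ℝ (fun Z => -f Z) X = -fderiv ℝ f X := fderiv_fun_neg
  ext i j
  simp [grad, h]

/-- Run time backwards and change the sign of the Hamiltonian. -/
theorem HamiltonianStep.symm {N : So n} {X Z : Sym n} (h : HamiltonianStep N X Z) :
    HamiltonianStep N Z X := by
  obtain ⟨f, hf, γ, rfl, rfl, hγ⟩ := h
  refine ⟨fun Z => -f Z, hf.neg, fun t => γ (1 - t), by simp, by simp, fun t ht => ?_⟩
  have h1 : HasDerivAt (fun t : ℝ => 1 - t) (-1) t := by
    simpa using (hasDerivAt_id t).const_sub 1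
  have h2 := (hγ (1 - t) ⟨by linarith [ht.2], by linarith [ht.1]⟩).scomp t h1
  refine h2.congr_deriv ?_
  rw [hamiltonianField, hamiltonianField, grad_neg, map_neg, neg_smul, one_smul]

/-- Linear differential equations with constant coefficients have global solutions. -/
theorem exists_hasDerivAt_linear {E : Type*} [NormedAddCommGroup E] [NormedSpace ℝ E]
    [FiniteDimensional ℝ E] (L : E →ₗ[ℝ] E) (x : E) :
    ∃ φ : ℝ → E, φ 0 = x ∧ ∀ t, HasDerivAt φ (L (φ t)) t := by
  have := FiniteDimensional.complete ℝ E
  exact ⟨fun t => NormedSpace.exp (t • LinearMap.toContinuousLinearMap L) x, by simp, fun t =>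
    (ContinuousLinearMap.apply ℝ E x).hasFDerivAt.comp_hasDerivAt t
      (hasDerivAt_exp_smul_const' (LinearMap.toContinuousLinearMap L) t)⟩

/-- The linear Hamiltonian vector field `X ↦ B_X(Y)`. -/
def linearField (N : So n) (Y : Sym n) : Sym n →ₗ[ℝ] Sym n :=
    { toFun := fun X => poissonTensor N X Y
      map_add' := fun X Z => Subtype.ext (by
        simp only [poissonTensor, LinearMap.coe_mk, AddHom.coe_mk, Submodule.coe_add]
        noncomm_ring)
      map_smul' := fun c X => Subtype.ext (by
        simp [poissonTensor, smul_sub]) }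

theorem exists_linearField_curve (N : So n) (X Y : Sym n) :
    ∃ φ : ℝ → Sym n, φ 0 = X ∧ ∀ t, HasDerivAt φ (poissonTensor N (φ t) Y) t :=
  exists_hasDerivAt_linear (linearField N Y) X

theorem grad_trace_mul (X Y : Sym n) :
    grad (fun Z => ((Y : Matrix (Fin n) (Fin n) ℝ) * Z).trace) X = Y := by
  let f : Sym n →L[ℝ] ℝ := LinearMap.toContinuousLinearMap
    ((Matrix.traceLinearMap (Fin n) ℝ ℝ).comp
      ((LinearMap.mulLeft ℝ (Y : Matrix (Fin n) (Fin n) ℝ)).comp (Sym n).subtype))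
  refine sub_eq_zero.1 (eq_zero_of_trace_mul _ fun Z => ?_)
  rw [Submodule.coe_sub, sub_mul, Matrix.trace_sub, trace_grad_mul]
  have h : fderiv ℝ (fun Z : Sym n => ((Y : Matrix (Fin n) (Fin n) ℝ) * Z).trace) X = f :=
    f.fderiv
  rw [h]
  exact sub_self _

/-- Scaling the linear Hamiltonian by `t` moves the endpoint to time one. -/
theorem hamiltonianStep_of_linearField {N : So n} {Y : Sym n} {φ : ℝ → Sym n}
    (hφ : ∀ t, HasDerivAt φ (poissonTensor N (φ t) Y) t) (t : ℝ) :
    HamiltonianStep N (φ 0) (φ t) := by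
  let f : Sym n →L[ℝ] ℝ := LinearMap.toContinuousLinearMap
    ((Matrix.traceLinearMap (Fin n) ℝ ℝ).comp
      ((LinearMap.mulLeft ℝ ((t • Y : Sym n) : Matrix (Fin n) (Fin n) ℝ)).comp (Sym n).subtype))
  refine ⟨fun Z => (((t • Y : Sym n) : Matrix (Fin n) (Fin n) ℝ) * Z).trace, f.contDiff,
    fun s => φ (s * t), by simp, by simp, fun s _ => ?_⟩
  have h1 : HasDerivAt (fun s : ℝ => s * t) t s := by
    simpa using (hasDerivAt_id s).mul_const t
  refine ((hφ (s * t)).scomp s h1).congr_deriv ?_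
  rw [hamiltonianField, grad_trace_mul, map_smul]

/-- The derivative of a polynomial function on `Sym(n)` along the vector field `X ↦ B_X(Y)`. -/
def lieDeriv (N : So n) (Y : Sym n) (q : MvPolynomial (Fin n × Fin n) ℝ) :
    MvPolynomial (Fin n × Fin n) ℝ :=
  ∑ ij : Fin n × Fin n, MvPolynomial.pderiv ij q *
    (Matrix.mvPolynomialX (Fin n) (Fin n) ℝ * (Y : Matrix (Fin n) (Fin n) ℝ).map MvPolynomial.C *
        (N : Matrix (Fin n) (Fin n) ℝ).map MvPolynomial.C -
      (N : Matrix (Fin n) (Fin n) ℝ).map MvPolynomial.C *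
        (Y : Matrix (Fin n) (Fin n) ℝ).map MvPolynomial.C *
        Matrix.mvPolynomialX (Fin n) (Fin n) ℝ :
      Matrix (Fin n) (Fin n) (MvPolynomial (Fin n × Fin n) ℝ)) ij.1 ij.2

theorem eval_lieDeriv (N : So n) (X Y : Sym n) (q : MvPolynomial (Fin n × Fin n) ℝ) :
    MvPolynomial.eval (entries (X : Matrix (Fin n) (Fin n) ℝ)) (lieDeriv N Y q) =
      ∑ ij : Fin n × Fin n,
        MvPolynomial.eval (entries (X : Matrix (Fin n) (Fin n) ℝ)) (MvPolynomial.pderiv ij q) *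
          (poissonTensor N X Y : Matrix (Fin n) (Fin n) ℝ) ij.1 ij.2 := by
  have h : (poissonTensor N X Y : Matrix (Fin n) (Fin n) ℝ) =
      (Matrix.mvPolynomialX (Fin n) (Fin n) ℝ * (Y : Matrix (Fin n) (Fin n) ℝ).map MvPolynomial.C *
        (N : Matrix (Fin n) (Fin n) ℝ).map MvPolynomial.C -
      (N : Matrix (Fin n) (Fin n) ℝ).map MvPolynomial.C *
        (Y : Matrix (Fin n) (Fin n) ℝ).map MvPolynomial.C *
        Matrix.mvPolynomialX (Fin n) (Fin n) ℝ).map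
          (MvPolynomial.eval (entries (X : Matrix (Fin n) (Fin n) ℝ))) := by
    rw [Matrix.map_sub _ (map_sub _), Matrix.map_mul, Matrix.map_mul, Matrix.map_mul,
      Matrix.map_mul, map_eval_map_C, map_eval_map_C, map_eval_mvPolynomialX]
    rfl
  rw [h, lieDeriv, map_sum]
  exact Finset.sum_congr rfl fun ij _ => by rw [map_mul, Matrix.map_apply]

theorem hasDerivAt_eval_curve {N : So n} {γ : ℝ → Sym n} {Y : Sym n} {t : ℝ}
    (h : HasDerivAt γ (poissonTensor N (γ t) Y) t) (q : MvPolynomial (Fin n × Fin n) ℝ) :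
    HasDerivAt (fun t => MvPolynomial.eval (entries (γ t : Matrix (Fin n) (Fin n) ℝ)) q)
      (MvPolynomial.eval (entries (γ t : Matrix (Fin n) (Fin n) ℝ)) (lieDeriv N Y q)) t := by
  rw [eval_lieDeriv]
  exact hasDerivAt_eval q (hasDerivAt_symVal h)

/-- Linearity in `Y` reduces any Hamiltonian field, whose gradient varies from point to point, to
the finitely many fixed directions `symUnit i j`. -/
theorem eval_lieDeriv_eq_sum (N : So n) (X Y : Sym n) (q : MvPolynomial (Fin n × Fin n) ℝ) :
    MvPolynomial.eval (entries (X : Matrix (Fin n) (Fin n) ℝ)) (lieDeriv N Y q) =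
      ∑ i, ∑ j, ((1 / 2 : ℝ) * (Y : Matrix (Fin n) (Fin n) ℝ) i j) *
        MvPolynomial.eval (entries (X : Matrix (Fin n) (Fin n) ℝ))
          (lieDeriv N (symUnit i j) q) := by
  let φ : Sym n →ₗ[ℝ] ℝ :=
    { toFun := fun Z => ∑ ij : Fin n × Fin n,
        MvPolynomial.eval (entries (X : Matrix (Fin n) (Fin n) ℝ)) (MvPolynomial.pderiv ij q) *
          (poissonTensor N X Z : Matrix (Fin n) (Fin n) ℝ) ij.1 ij.2
      map_add' := fun Z W => by
        simp only [map_add, Submodule.coe_add, Matrix.add_apply, mul_add, Finset.sum_add_distrib]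
      map_smul' := fun c Z => by
        simp only [map_smul, Submodule.coe_smul, Matrix.smul_apply, smul_eq_mul, Finset.mul_sum,
          RingHom.id_apply]
        exact Finset.sum_congr rfl fun _ _ => by ring }
  have hφ : ∀ Z, MvPolynomial.eval (entries (X : Matrix (Fin n) (Fin n) ℝ)) (lieDeriv N Z q) = φ Z :=
    fun Z => eval_lieDeriv N X Z q
  simp only [hφ]
  conv_lhs => rw [sym_eq_sum Y]
  simp only [map_sum, map_smul, smul_eq_mul]

/-- The common zeros of an ideal of polynomials that is stable under the derivatives along the
linear Hamiltonian fields form a union of symplectic leaves. -/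
theorem HamiltonianStep.eval_eq_zero {N : So n} {X Z : Sym n} (h : HamiltonianStep N X Z)
    {I : Ideal (MvPolynomial (Fin n × Fin n) ℝ)}
    (hI : ∀ Y : Sym n, ∀ q ∈ I, lieDeriv N Y q ∈ I)
    (hX : ∀ q ∈ I, MvPolynomial.eval (entries (X : Matrix (Fin n) (Fin n) ℝ)) q = 0) :
    ∀ q ∈ I, MvPolynomial.eval (entries (Z : Matrix (Fin n) (Fin n) ℝ)) q = 0 := by
  obtain ⟨f, hf, γ, rfl, rfl, hγ⟩ := h
  obtain ⟨s, hs⟩ := (isNoetherianRing_iff_ideal_fg _).1 inferInstance I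
  have hmem : ∀ g : s, (g : MvPolynomial (Fin n × Fin n) ℝ) ∈ I := fun g =>
    hs ▸ Submodule.subset_span g.2
  -- The derivative of each generator is again a polynomial combination of the generators, so their
  -- values along `γ` solve a linear system `u' = a(t) u`.
  have hcoef : ∀ (i j : Fin n) (g : s), ∃ c : s → MvPolynomial (Fin n × Fin n) ℝ,
      ∑ l, c l • (l : MvPolynomial (Fin n × Fin n) ℝ) = lieDeriv N (symUnit i j) g := by
    intro i j g
    refine Submodule.mem_span_finset'.1 ?_
    have := hI (symUnit i j) g (hmem g)
    rwa [← hs] at this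
  choose c hc using hcoef
  set u : ℝ → s → ℝ := fun t g =>
    MvPolynomial.eval (entries (γ t : Matrix (Fin n) (Fin n) ℝ)) g with hu
  set a : ℝ → s → s → ℝ := fun t g l => ∑ i, ∑ j,
    ((1 / 2 : ℝ) * (grad f (γ t) : Matrix (Fin n) (Fin n) ℝ) i j) *
      MvPolynomial.eval (entries (γ t : Matrix (Fin n) (Fin n) ℝ)) (c i j g l) with ha
  have hder : ∀ t ∈ Set.Icc (0 : ℝ) 1, HasDerivAt u (fun g => ∑ l, a t g l * u t l) t := by
    intro t ht
    rw [hasDerivAt_pi]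
    intro g
    refine (hasDerivAt_eval_curve (hγ t ht) _).congr_deriv ?_
    rw [eval_lieDeriv_eq_sum]
    simp only [ha, hu, ← hc, map_sum, smul_eq_mul, map_mul, Finset.mul_sum, Finset.sum_mul,
      mul_assoc]
    exact (Finset.sum_congr rfl fun _ _ => Finset.sum_comm).trans Finset.sum_comm
  have hcontγ : ContinuousOn γ (Set.Icc 0 1) := fun t ht =>
    (hγ t ht).continuousAt.continuousWithinAt
  have hcontgrad : ∀ i j, Continuous fun X => (grad f X : Matrix (Fin n) (Fin n) ℝ) i j :=
    fun i j => continuous_const.mul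
      ((hf.continuous_fderiv (by simp)).clm_apply continuous_const)
  have hconta : ∀ g l, ContinuousOn (fun t => a t g l) (Set.Icc 0 1) := fun g l =>
    continuousOn_finsetSum _ fun i _ => continuousOn_finsetSum _ fun j _ =>
      (continuousOn_const.mul ((hcontgrad i j).comp_continuousOn hcontγ)).mul
        ((contDiff_eval (c i j g l)).continuous.comp_continuousOn hcontγ)
  -- A bound for the sum of all `|a t g l|` dominates the operator in the sup norm; Gronwall's
  -- inequality with `u 0 = 0` then gives `u = 0`.
  obtain ⟨K, hK⟩ := isCompact_Icc.exists_bound_of_continuousOn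
    (continuousOn_finsetSum Finset.univ fun g _ =>
      continuousOn_finsetSum Finset.univ fun l _ => (hconta g l).abs)
  have hzero := eq_zero_of_abs_deriv_le_mul_abs_self_of_eq_zero_right (f := u) (K := K) (a := 0)
    (b := 1) (fun t ht => (hder t ht).continuousAt.continuousWithinAt)
    (fun t ht => (hder t (Set.Ico_subset_Icc_self ht)).hasDerivWithinAt)
    (funext fun g => hX g (hmem g)) (by
      intro t ht
      have hKt := hK t (Set.Ico_subset_Icc_self ht)
      rw [Real.norm_of_nonneg (Finset.sum_nonneg fun _ _ => Finset.sum_nonneg fun _ _ =>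
        abs_nonneg _)] at hKt
      refine le_trans ?_ (mul_le_mul_of_nonneg_right hKt (norm_nonneg _))
      refine (pi_norm_le_iff_of_nonneg (mul_nonneg (Finset.sum_nonneg fun _ _ =>
        Finset.sum_nonneg fun _ _ => abs_nonneg _) (norm_nonneg _))).2 fun g => ?_
      calc ‖∑ l, a t g l * u t l‖ ≤ ∑ l, ‖a t g l * u t l‖ := norm_sum_le _ _
        _ ≤ ∑ l, |a t g l| * ‖u t‖ := Finset.sum_le_sum fun l _ => by
            rw [norm_mul, Real.norm_eq_abs]
            exact mul_le_mul_of_nonneg_left (norm_le_pi_norm _ _) (abs_nonneg _)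
        _ = (∑ l, |a t g l|) * ‖u t‖ := by rw [Finset.sum_mul]
        _ ≤ _ := by
            refine mul_le_mul_of_nonneg_right ?_ (norm_nonneg _)
            exact Finset.single_le_sum (f := fun g => ∑ l, |a t g l|)
              (fun _ _ => Finset.sum_nonneg fun _ _ => abs_nonneg _) (Finset.mem_univ g))
  intro q hq
  rw [← hs] at hq
  obtain ⟨d, rfl⟩ := Submodule.mem_span_finset'.1 hq
  rw [map_sum]
  refine Finset.sum_eq_zero fun g _ => ?_
  rw [smul_eq_mul, map_mul]
  have := congrFun (hzero 1 (Set.right_mem_Icc.2 zero_le_one)) g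
  simp only [hu, Pi.zero_apply] at this
  rw [this, mul_zero]

/-- Suppose `q` vanishes on the part of the leaf in an open `U` around `X`. All polynomials
vanishing there form an ideal stable under the linear fields, since their flows stay in `U` for
short times and in the leaf. Its zeros propagate from `X` back to `X₀`, a contradiction. -/
theorem leaf_subset_closure {N : So n} {X₀ : Sym n} {q : MvPolynomial (Fin n × Fin n) ℝ}
    (hq : MvPolynomial.eval (entries (X₀ : Matrix (Fin n) (Fin n) ℝ)) q ≠ 0) :
    leaf N X₀ ⊆ closure (leaf N X₀ ∩
      {X : Sym n | MvPolynomial.eval (entries (X : Matrix (Fin n) (Fin n) ℝ)) q ≠ 0}) := by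
  intro X hX
  rw [mem_closure_iff]
  intro U hU hXU
  by_contra hempty
  have hvan : ∀ Z ∈ U, Z ∈ leaf N X₀ →
      MvPolynomial.eval (entries (Z : Matrix (Fin n) (Fin n) ℝ)) q = 0 := fun Z hZ hZL =>
    by_contra fun h => hempty ⟨Z, hZ, hZL, h⟩
  let I : Ideal (MvPolynomial (Fin n × Fin n) ℝ) :=
    { carrier := {r | ∀ Z ∈ U, Z ∈ leaf N X₀ →
        MvPolynomial.eval (entries (Z : Matrix (Fin n) (Fin n) ℝ)) r = 0}
      add_mem' := fun ha hb Z hZ hZL => by rw [map_add, ha Z hZ hZL, hb Z hZ hZL, add_zero]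
      zero_mem' := fun Z _ _ => map_zero _
      smul_mem' := fun c r hr Z hZ hZL => by rw [smul_eq_mul, map_mul, hr Z hZ hZL, mul_zero] }
  have hI : ∀ Y : Sym n, ∀ r ∈ I, lieDeriv N Y r ∈ I := by
    intro Y r hr Z hZ hZL
    obtain ⟨φ, h0, hφ⟩ := exists_linearField_curve N Z Y
    have h2 := hasDerivAt_eval_curve (hφ 0) r
    rw [h0] at h2
    refine h2.unique ((hasDerivAt_const (0 : ℝ) (0 : ℝ)).congr_of_eventuallyEq ?_)
    have hU' : ∀ᶠ t : ℝ in nhds 0, φ t ∈ U :=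
      (hφ 0).continuousAt.eventually_mem (by rw [h0]; exact hU.mem_nhds hZ)
    filter_upwards [hU'] with t ht
    exact hr _ ht (hZL.tail (h0 ▸ hamiltonianStep_of_linearField hφ t))
  have hback : ∀ Z : Sym n, Relation.ReflTransGen (HamiltonianStep N) Z X →
      ∀ r ∈ I, MvPolynomial.eval (entries (Z : Matrix (Fin n) (Fin n) ℝ)) r = 0 := by
    intro Z hZ
    induction hZ using Relation.ReflTransGen.head_induction_on with
    | refl => exact fun r hr => hr X hXU hX
    | head h _ ih => exact h.symm.eval_eq_zero hI ih
  exact hq (hback X₀ hX q hvan)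

end Leaf

/-! ### Matrices with simple spectrum, their commutants and Hankel determinants. -/

section DistinctEigenvalues

variable {n : ℕ}

theorem exists_diagonalization (A : Matrix (Fin n) (Fin n) ℂ) {ν : Fin n → ℂ}
    (hν : Function.Injective ν) (hroot : ∀ i, A.charpoly.IsRoot (ν i)) :
    ∃ P : Matrix (Fin n) (Fin n) ℂ, IsUnit P ∧ A * P = P * Matrix.diagonal ν := by
  have hv : ∀ i, ∃ v : Fin n → ℂ, v ≠ 0 ∧ A *ᵥ v = ν i • v := by
    intro i
    have h := hroot i
    rw [Polynomial.IsRoot, Matrix.eval_charpoly, ← Matrix.exists_mulVec_eq_zero_iff] at h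
    obtain ⟨v, hv, h⟩ := h
    refine ⟨v, hv, ?_⟩
    rw [Matrix.sub_mulVec, Matrix.scalar_apply, ← Matrix.smul_one_eq_diagonal, Matrix.smul_mulVec,
      Matrix.one_mulVec, sub_eq_zero] at h
    exact h.symm
  choose v hv0 hv using hv
  have hli : LinearIndependent ℂ v :=
    Module.End.eigenvectors_linearIndependent' (Matrix.toLin' A) ν hν v fun i =>
      ⟨Module.End.mem_eigenspace_iff.2 (by rw [Matrix.toLin'_apply, hv]), hv0 i⟩
  refine ⟨(Matrix.of v)ᵀ, Matrix.linearIndependent_cols_iff_isUnit.1 hli, ?_⟩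
  ext i j
  rw [Matrix.mul_diagonal]
  have := congrFun (hv j) i
  rw [Pi.smul_apply, smul_eq_mul, mul_comm] at this
  exact this

theorem exists_injective_roots (A : Matrix (Fin n) (Fin n) ℂ) (h : A.charpoly.roots.Nodup) :
    ∃ ν : Fin n → ℂ, Function.Injective ν ∧ ∀ i, A.charpoly.IsRoot (ν i) := by
  have hcard : A.charpoly.roots.toFinset.card = n := by
    rw [Multiset.toFinset_card_of_nodup h, ← (IsAlgClosed.splits A.charpoly).natDegree_eq_card_roots,
      Matrix.charpoly_natDegree_eq_dim, Fintype.card_fin]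
  let e := (Finset.equivFinOfCardEq hcard).symm
  refine ⟨fun i => e i, Subtype.val_injective.comp e.injective, fun i => ?_⟩
  exact Polynomial.isRoot_of_mem_roots (Multiset.mem_toFinset.1 (e i).2)

theorem aeval_mul_of_mul_eq {A P D : Matrix (Fin n) (Fin n) ℂ} (h : A * P = P * D)
    (f : Polynomial ℂ) : Polynomial.aeval A f * P = P * Polynomial.aeval D f := by
  induction f using Polynomial.induction_on' with
  | add f g hf hg => rw [map_add, map_add, add_mul, mul_add, hf, hg]
  | monomial k a =>
    have hk : A ^ k * P = P * D ^ k := by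
      induction k with
      | zero => simp
      | succ k ih => rw [pow_succ, mul_assoc, h, ← mul_assoc, ih, mul_assoc, ← pow_succ]
    rw [Polynomial.aeval_monomial, Polynomial.aeval_monomial, mul_assoc, hk, ← mul_assoc,
      ← mul_assoc, Algebra.commutes]

theorem aeval_diagonal (ν : Fin n → ℂ) (f : Polynomial ℂ) :
    Polynomial.aeval (Matrix.diagonal ν) f = Matrix.diagonal fun i => f.eval (ν i) := by
  induction f using Polynomial.induction_on' with
  | add f g hf hg => rw [map_add, hf, hg, Matrix.diagonal_add]; simp
  | monomial k a =>
    rw [Polynomial.aeval_monomial, Matrix.diagonal_pow, Matrix.algebraMap_eq_diagonal,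
      Matrix.diagonal_mul_diagonal]
    simp

theorem aeval_eq_sum_fin (A : Matrix (Fin n) (Fin n) ℂ) {f : Polynomial ℂ} {m : ℕ}
    (hf : f.natDegree < m) : Polynomial.aeval A f = ∑ i : Fin m, f.coeff i • A ^ (i : ℕ) := by
  rw [Polynomial.aeval_eq_sum_range' hf, Finset.sum_range]

theorem map_algebraMap_aeval (A : Matrix (Fin n) (Fin n) ℝ) (f : Polynomial ℝ) :
    (Polynomial.aeval A f).map (algebraMap ℝ ℂ) =
      Polynomial.aeval (A.map (algebraMap ℝ ℂ)) (f.map (algebraMap ℝ ℂ)) := by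
  rw [Polynomial.aeval_map_algebraMap]
  exact (Polynomial.aeval_algHom_apply (Algebra.ofId ℝ ℂ).mapMatrix A f).symm

theorem eq_zero_of_aeval_eq_zero {A : Matrix (Fin n) (Fin n) ℝ}
    (hA : (A.map (algebraMap ℝ ℂ)).charpoly.roots.Nodup) {f : Polynomial ℝ}
    (hf : Polynomial.aeval A f = 0) (hdeg : f.natDegree < n) : f = 0 := by
  obtain ⟨ν, hν, hroot⟩ := exists_injective_roots _ hA
  obtain ⟨P, hP, hAP⟩ := exists_diagonalization _ hν hroot
  have h := aeval_mul_of_mul_eq hAP (f.map (algebraMap ℝ ℂ))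
  rw [← map_algebraMap_aeval, hf, Matrix.map_zero _ (map_zero _), zero_mul, eq_comm,
    hP.mul_right_eq_zero, aeval_diagonal] at h
  have h0 := Polynomial.eq_zero_of_natDegree_lt_card_of_eval_eq_zero (f.map (algebraMap ℝ ℂ)) hν
    (fun i => by simpa using congrFun (congrFun h i) i) (by simpa using hdeg)
  exact (Polynomial.map_eq_zero _).1 h0

theorem linearIndependent_pow_of_nodup {A : Matrix (Fin n) (Fin n) ℝ}
    (hA : (A.map (algebraMap ℝ ℂ)).charpoly.roots.Nodup) :
    LinearIndependent ℝ fun i : Fin n => A ^ (i : ℕ) := by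
  rw [Fintype.linearIndependent_iff]
  intro c hc i
  set f : Polynomial ℝ := ∑ i : Fin n, Polynomial.monomial i (c i) with hfdef
  have hcoeff : f.coeff i = c i := by
    simp [hfdef, Polynomial.finsetSum_coeff, Polynomial.coeff_monomial, Fin.val_inj]
  have hdeg : f.natDegree < n :=
    lt_of_le_of_lt (Polynomial.natDegree_sum_le_of_forall_le (n := n - 1) _ _ fun j _ =>
      (Polynomial.natDegree_monomial_le _).trans (by omega)) (by have := i.2; omega)
  have haeval : Polynomial.aeval A f = 0 := by
    rw [hfdef, map_sum, ← hc]
    exact Finset.sum_congr rfl fun j _ => by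
      rw [Polynomial.aeval_monomial, ← Algebra.smul_def]
  rw [← hcoeff, eq_zero_of_aeval_eq_zero hA haeval hdeg, Polynomial.coeff_zero]

theorem exists_sum_pow_of_commute {A Z : Matrix (Fin n) (Fin n) ℝ}
    (hA : (A.map (algebraMap ℝ ℂ)).charpoly.roots.Nodup) (hZ : Commute Z A) :
    ∃ c : Fin n → ℝ, Z = ∑ i, c i • A ^ (i : ℕ) := by
  obtain ⟨ν, hν, hroot⟩ := exists_injective_roots _ hA
  obtain ⟨P, hP, hAP⟩ := exists_diagonalization _ hν hroot
  obtain ⟨Q, hQP, hPQ⟩ : ∃ Q, Q * P = 1 ∧ P * Q = 1 := by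
    obtain ⟨u, rfl⟩ := hP
    exact ⟨↑u⁻¹, u.inv_mul, u.mul_inv⟩
  set B := A.map (algebraMap ℝ ℂ) with hB
  set W := Z.map (algebraMap ℝ ℂ) with hW
  have hcomm : W * B = B * W := by
    rw [hB, hW, ← Matrix.map_mul, ← Matrix.map_mul, hZ.eq]
  have hD : Q * W * P * Matrix.diagonal ν = Matrix.diagonal ν * (Q * W * P) := by
    have hQB : Q * B = Matrix.diagonal ν * Q := by
      calc Q * B = Q * (B * P) * Q := by rw [mul_assoc, mul_assoc, hPQ, mul_one]
        _ = _ := by rw [hAP, ← mul_assoc Q P, hQP, one_mul]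
    calc Q * W * P * Matrix.diagonal ν = Q * (W * B) * P := by
          rw [mul_assoc _ P, ← hAP]; simp only [mul_assoc]
      _ = Q * B * W * P := by rw [hcomm]; simp only [mul_assoc]
      _ = _ := by rw [hQB]; simp only [mul_assoc]
  have hdiag : Q * W * P = Matrix.diagonal fun i => (Q * W * P) i i := by
    ext i j
    by_cases hij : i = j
    · subst hij; rw [Matrix.diagonal_apply_eq]
    · rw [Matrix.diagonal_apply_ne _ hij]
      have := congrFun (congrFun hD i) j
      rw [Matrix.mul_diagonal, Matrix.diagonal_mul, mul_comm, ← sub_eq_zero, ← sub_mul] at this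
      exact (mul_eq_zero.1 this).resolve_left (sub_ne_zero.2 fun h => hij (hν h).symm)
  -- In the eigenbasis `Z` is diagonal; interpolating its diagonal at the eigenvalues expresses it
  -- as a polynomial in `A`.
  set f := Lagrange.interpolate Finset.univ ν fun i => (Q * W * P) i i with hf
  have hfdeg : f.degree < n := by
    have h := Lagrange.degree_interpolate_lt (s := Finset.univ) (v := ν)
      (fun i => (Q * W * P) i i) hν.injOn
    rwa [Finset.card_univ, Fintype.card_fin] at h
  have hfW : Polynomial.aeval B f = W := by
    have h := aeval_mul_of_mul_eq hAP f
    have he : (Matrix.diagonal fun i => f.eval (ν i)) = Q * W * P := by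
      rw [hdiag]
      congr 1
      funext i
      exact Lagrange.eval_interpolate_at_node _ hν.injOn (Finset.mem_univ i)
    rw [aeval_diagonal, he] at h
    calc Polynomial.aeval B f = Polynomial.aeval B f * P * Q := by rw [mul_assoc, hPQ, mul_one]
      _ = (P * Q) * W * (P * Q) := by rw [h]; simp only [mul_assoc]
      _ = W := by rw [hPQ, one_mul, mul_one]
  -- As `A` and `Z` are real, the real parts of the coefficients already represent `Z`.
  refine ⟨fun i => (f.coeff i).re, ?_⟩
  ext a b
  have hn : 0 < n := a.pos
  have hnat : f.natDegree < n := by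
    by_cases hf0 : f = 0
    · rwa [hf0, Polynomial.natDegree_zero]
    · exact (Polynomial.natDegree_lt_iff_degree_lt hf0).2 hfdeg
  have h1 : (Z a b : ℂ) = ∑ i : Fin n, f.coeff i * ((A ^ (i : ℕ)) a b : ℂ) := by
    have h2 : ∀ k : ℕ, B ^ k = (A ^ k).map (algebraMap ℝ ℂ) := fun k => by
      rw [hB, ← RingHom.mapMatrix_apply, ← map_pow, RingHom.mapMatrix_apply]
    have h3 := congrFun (congrFun hfW a) b
    rw [aeval_eq_sum_fin B hnat, Matrix.sum_apply] at h3
    simp only [h2, Matrix.smul_apply, Matrix.map_apply, smul_eq_mul] at h3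
    exact h3.symm
  have h4 := congrArg Complex.re h1
  rw [Complex.re_sum] at h4
  simpa [Matrix.sum_apply] using h4

theorem minpoly_eq_charpoly_of_nodup {A : Matrix (Fin n) (Fin n) ℝ}
    (hA : (A.map (algebraMap ℝ ℂ)).charpoly.roots.Nodup) : minpoly ℝ A = A.charpoly := by
  have hint : IsIntegral ℝ A := Matrix.isIntegral A
  refine (Polynomial.eq_of_monic_of_dvd_of_natDegree_le (minpoly.monic hint) A.charpoly_monic
    (Matrix.minpoly_dvd_charpoly A) ?_).symm
  rw [Matrix.charpoly_natDegree_eq_dim, Fintype.card_fin]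
  by_contra! h
  exact minpoly.ne_zero hint (eq_zero_of_aeval_eq_zero hA (minpoly.aeval ℝ A) h)

/-- Transposition turns `-c - N` into `-(c - N)`, and the odd size produces the sign. -/
theorem charpoly_comp_neg_of_skew {K : Type*} [Field K] [Infinite K] {p : ℕ}
    {N : Matrix (Fin (2 * p + 1)) (Fin (2 * p + 1)) K} (hN : Nᵀ = -N) :
    N.charpoly.comp (-Polynomial.X) = -N.charpoly := by
  refine Polynomial.funext fun c => ?_
  rw [Polynomial.eval_comp, Polynomial.eval_neg, Polynomial.eval_neg, Polynomial.eval_X,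
    Matrix.eval_charpoly, Matrix.eval_charpoly, ← Matrix.det_transpose, Matrix.transpose_sub, hN]
  have h : (Matrix.scalar (Fin (2 * p + 1)) (-c))ᵀ - -N =
      -(Matrix.scalar (Fin (2 * p + 1)) c - N) := by
    rw [map_neg, Matrix.transpose_neg, Matrix.scalar_apply, Matrix.diagonal_transpose]
    abel
  rw [h, Matrix.det_neg, Fintype.card_fin, Odd.neg_one_pow ⟨p, rfl⟩, neg_one_mul]

theorem exists_minpoly_eq {p : ℕ} {N : Matrix (Fin (2 * p + 1)) (Fin (2 * p + 1)) ℝ}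
    (hN : Nᵀ = -N) (hdistinct : (N.map (algebraMap ℝ ℂ)).charpoly.roots.Nodup) :
    ∃ w : Polynomial ℝ, w.natDegree = p ∧
      minpoly ℝ N = Polynomial.X * w.comp (Polynomial.X ^ 2) := by
  rw [minpoly_eq_charpoly_of_nodup hdistinct]
  set f := N.charpoly with hf
  have hdeg : f.natDegree = 2 * p + 1 := by
    rw [hf, Matrix.charpoly_natDegree_eq_dim, Fintype.card_fin]
  have heven : ∀ k, f.coeff (2 * k) = 0 := by
    intro k
    have h := congrArg (fun g => Polynomial.coeff g (2 * k)) (charpoly_comp_neg_of_skew hN)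
    have hX : (-Polynomial.X : Polynomial ℝ) = Polynomial.C (-1) * Polynomial.X := by simp
    simp only [hX, Polynomial.comp_C_mul_X_coeff, Polynomial.coeff_neg] at h
    rw [← hf, pow_mul, neg_one_sq, one_pow, mul_one] at h
    linarith
  set w : Polynomial ℝ := ∑ k ∈ Finset.range (p + 1), Polynomial.monomial k (f.coeff (2 * k + 1))
    with hw
  have hwc : ∀ k, w.coeff k = if k < p + 1 then f.coeff (2 * k + 1) else 0 := by
    intro k
    simp [hw, Polynomial.finsetSum_coeff, Polynomial.coeff_monomial]
  have heq : f = Polynomial.X * w.comp (Polynomial.X ^ 2) := by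
    rw [← Polynomial.expand_eq_comp_X_pow]
    ext k
    cases k with
    | zero => simpa using heven 0
    | succ k =>
      rw [Polynomial.coeff_X_mul, Polynomial.coeff_expand two_pos]
      split_ifs with h
      · obtain ⟨k, rfl⟩ := h
        rw [Nat.mul_div_cancel_left _ two_pos, hwc]
        split_ifs with hk
        · rfl
        · exact Polynomial.coeff_eq_zero_of_natDegree_lt (by omega)
      · obtain ⟨j, rfl⟩ : ∃ j, k = 2 * j + 1 := ⟨k / 2, by omega⟩
        exact heven (j + 1)
  refine ⟨w, le_antisymm ?_ ?_, heq⟩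
  · refine Polynomial.natDegree_le_iff_coeff_eq_zero.2 fun k hk => ?_
    rw [hwc, if_neg (by omega)]
  · refine Polynomial.le_natDegree_of_ne_zero ?_
    rw [hwc, if_pos (Nat.lt_succ_self p), ← hdeg]
    exact fun h => (Matrix.charpoly_monic N).ne_zero (Polynomial.leadingCoeff_eq_zero.1 h)

/-- The Hankel matrix of the power sums of the eigenvalues of `A`. -/
def hankel {R : Type*} [CommRing R] (A : Matrix (Fin n) (Fin n) R) : Matrix (Fin n) (Fin n) R :=
  Matrix.of fun i j => (A ^ ((i : ℕ) + j)).trace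

theorem hankel_map {R S : Type*} [CommRing R] [CommRing S] (f : R →+* S)
    (A : Matrix (Fin n) (Fin n) R) : hankel (A.map f) = (hankel A).map f := by
  ext i j
  simp only [hankel, Matrix.of_apply, Matrix.map_apply, AddMonoidHom.map_trace]
  rw [← RingHom.mapMatrix_apply, ← RingHom.mapMatrix_apply, map_pow]

/-- With a repeated root, the product `g` over the distinct roots has degree below `n` and `g(A)` is
nilpotent. Then all `A^i g(A)` have trace zero, so the coefficients of `g` form a kernel vector of
the Hankel matrix. -/
theorem nodup_roots_of_det_hankel_ne_zero {A : Matrix (Fin n) (Fin n) ℂ}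
    (h : (hankel A).det ≠ 0) : A.charpoly.roots.Nodup := by
  by_contra hdup
  set s := A.charpoly.roots.toFinset with hs
  set g : Polynomial ℂ := ∏ a ∈ s, (Polynomial.X - Polynomial.C a) with hg
  have hmonic : g.Monic := Polynomial.monic_prod_of_monic _ _ fun a _ => Polynomial.monic_X_sub_C a
  have hroots : A.charpoly.roots.card = n := by
    rw [← (IsAlgClosed.splits A.charpoly).natDegree_eq_card_roots, Matrix.charpoly_natDegree_eq_dim,
      Fintype.card_fin]
  have hdeg : g.natDegree < n := by
    rw [hg, Polynomial.natDegree_prod_of_monic _ _ fun a _ => Polynomial.monic_X_sub_C a]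
    simp only [Polynomial.natDegree_X_sub_C, Finset.sum_const, smul_eq_mul, mul_one]
    refine lt_of_le_of_ne (hroots ▸ Multiset.toFinset_card_le _) fun hcard => hdup ?_
    rw [← Multiset.toFinset_card_eq_card_iff_nodup, hroots]; exact hcard
  have hdvd : A.charpoly ∣ g ^ n := by
    rw [(IsAlgClosed.splits A.charpoly).eq_prod_roots_of_monic A.charpoly_monic,
      Finset.prod_multiset_map_count, hg, ← Finset.prod_pow]
    exact Finset.prod_dvd_prod_of_dvd _ _ fun a _ => pow_dvd_pow _
      ((Multiset.count_le_card a _).trans hroots.le)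
  have hnil : Polynomial.aeval A g ^ n = 0 := by
    obtain ⟨r, hr⟩ := hdvd
    rw [← map_pow, hr, map_mul, Matrix.aeval_self_charpoly, zero_mul]
  have htr : ∀ i : ℕ, (A ^ i * Polynomial.aeval A g).trace = 0 := by
    intro i
    have hcomm : Commute (A ^ i) (Polynomial.aeval A g) := by
      have h := (Commute.all (Polynomial.X ^ i) g).map (Polynomial.aeval A)
      rwa [Polynomial.aeval_X_pow] at h
    refine (Matrix.isNilpotent_trace_of_isNilpotent ⟨n, ?_⟩).eq_zero
    rw [hcomm.mul_pow, hnil, mul_zero]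
  refine h (Matrix.exists_mulVec_eq_zero_iff.1 ⟨fun j : Fin n => g.coeff j, fun h0 => ?_, ?_⟩)
  · have := congrFun h0 ⟨g.natDegree, hdeg⟩
    simp only [Pi.zero_apply] at this
    exact hmonic.ne_zero (Polynomial.leadingCoeff_eq_zero.1 this)
  · funext i
    have := htr i
    rw [aeval_eq_sum_fin A hdeg, Finset.mul_sum, Matrix.trace_sum] at this
    rw [Pi.zero_apply, ← this, Matrix.mulVec, dotProduct]
    refine Finset.sum_congr rfl fun j _ => ?_
    rw [hankel, Matrix.of_apply, Matrix.mul_smul, Matrix.trace_smul, pow_add, smul_eq_mul, mul_comm]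

/-- A kernel vector `c` gives `F = ∑ c_j N^j` with `tr (N^i F) = 0` for `i < n`. Skewness makes `Fᵀ`
a combination of the same powers, so `tr (Fᵀ F) = 0` and `F = 0`. -/
theorem det_hankel_ne_zero_of_skew {N : Matrix (Fin n) (Fin n) ℝ} (hN : Nᵀ = -N)
    (hdistinct : (N.map (algebraMap ℝ ℂ)).charpoly.roots.Nodup) : (hankel N).det ≠ 0 := by
  intro h
  obtain ⟨c, hc0, hc⟩ := Matrix.exists_mulVec_eq_zero_iff.2 h
  set F := ∑ j : Fin n, c j • N ^ (j : ℕ) with hF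
  have htr : ∀ i : Fin n, (N ^ (i : ℕ) * F).trace = 0 := by
    intro i
    rw [hF, Finset.mul_sum, Matrix.trace_sum]
    refine Eq.trans ?_ (congrFun hc i)
    rw [Matrix.mulVec, dotProduct]
    refine Finset.sum_congr rfl fun j _ => ?_
    rw [hankel, Matrix.of_apply, Matrix.mul_smul, Matrix.trace_smul, pow_add, smul_eq_mul, mul_comm]
  have hFF : (Fᴴ * F).trace = 0 := by
    have h1 : Fᴴ = ∑ j : Fin n, (c j * (-1) ^ (j : ℕ)) • N ^ (j : ℕ) := by
      rw [Matrix.conjTranspose_eq_transpose_of_trivial, hF, Matrix.transpose_sum]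
      refine Finset.sum_congr rfl fun j _ => ?_
      rw [Matrix.transpose_smul, Matrix.transpose_pow, hN, ← neg_one_smul ℝ N, smul_pow, smul_smul]
    rw [h1, Finset.sum_mul, Matrix.trace_sum]
    refine Finset.sum_eq_zero fun j _ => ?_
    rw [Matrix.smul_mul, Matrix.trace_smul, htr, smul_zero]
  rw [Matrix.trace_conjTranspose_mul_self_eq_zero_iff] at hFF
  exact hc0 (funext (Fintype.linearIndependent_iff.1 (linearIndependent_pow_of_nodup hdistinct) c
    hFF))

end DistinctEigenvalues

/-! ### The kernel and the rank of the Poisson tensor. -/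

section Rank

variable {n : ℕ}

/-- Symmetric matrices as functions on unordered pairs of indices. -/
def symEquivSym2 (n : ℕ) : Sym n ≃ₗ[ℝ] (Sym2 (Fin n) → ℝ) where
  toFun X := Sym2.lift ⟨fun i j => (X : Matrix (Fin n) (Fin n) ℝ) i j, fun i j =>
    congrFun (congrFun (sym_transpose X) j) i⟩
  invFun f := ⟨Matrix.of fun i j => f s(i, j), by
    change Matrix.IsSymm _
    ext i j
    simp [Sym2.eq_swap]⟩
  map_add' X Y := by
    funext s
    induction s with
    | _ i j => simp
  map_smul' c X := by
    funext s
    induction s with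
    | _ i j => simp
  left_inv X := Subtype.ext (by ext i j; simp)
  right_inv f := by
    funext s
    induction s with
    | _ i j => simp

theorem finrank_sym (n : ℕ) : Module.finrank ℝ (Sym n) = (n + 1).choose 2 := by
  rw [(symEquivSym2 n).finrank_eq, Module.finrank_fintype_fun_eq_card, Sym2.card, Fintype.card_fin]

theorem adjugate_transpose_sym (X : Sym n) :
    (X : Matrix (Fin n) (Fin n) ℝ).adjugateᵀ = (X : Matrix (Fin n) (Fin n) ℝ).adjugate := by
  rw [Matrix.adjugate_transpose, sym_transpose]

theorem pow_mul_adjugate_transpose (N : So n) (X : Sym n) (k : ℕ) :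
    (((X : Matrix (Fin n) (Fin n) ℝ).adjugate * (N : Matrix (Fin n) (Fin n) ℝ)) ^ k *
      (X : Matrix (Fin n) (Fin n) ℝ).adjugate)ᵀ =
    (-1 : ℝ) ^ k • (((X : Matrix (Fin n) (Fin n) ℝ).adjugate *
      (N : Matrix (Fin n) (Fin n) ℝ)) ^ k * (X : Matrix (Fin n) (Fin n) ℝ).adjugate) := by
  have h : ∀ A B : Matrix (Fin n) (Fin n) ℝ, A * (B * A) ^ k = (A * B) ^ k * A := by
    intro A B
    induction k with
    | zero => simp
    | succ k ih => rw [pow_succ', pow_succ', ← mul_assoc, ← mul_assoc, mul_assoc _ A, ih, mul_assoc _ _ A]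
  rw [Matrix.transpose_mul, Matrix.transpose_pow, Matrix.transpose_mul, so_transpose,
    adjugate_transpose_sym, neg_mul, ← neg_one_smul ℝ ((N : Matrix (Fin n) (Fin n) ℝ) * _), smul_pow,
    Matrix.mul_smul, h]

/-- The symmetric matrices `(adj X N) ^ (2 j) adj X`, which span the kernel of `B_X` for generic
`X`. -/
def kernelElement (N : So n) (X : Sym n) (j : ℕ) : Sym n :=
  ⟨((X : Matrix (Fin n) (Fin n) ℝ).adjugate * (N : Matrix (Fin n) (Fin n) ℝ)) ^ (2 * j) *
    (X : Matrix (Fin n) (Fin n) ℝ).adjugate, by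
    change Matrix.IsSymm _
    rw [Matrix.IsSymm, pow_mul_adjugate_transpose, pow_mul, neg_one_sq, one_pow, one_smul]⟩

theorem mul_pow_mul_adjugate (N X : Matrix (Fin n) (Fin n) ℝ) (k : ℕ) :
    X * ((X.adjugate * N) ^ k * X.adjugate) * N = N * ((X.adjugate * N) ^ k * X.adjugate) * X := by
  have h1 : (X.adjugate * N) ^ k * X.adjugate * N = X.adjugate * N * (X.adjugate * N) ^ k := by
    rw [mul_assoc, ← pow_succ, ← pow_succ']
  have h2 : (X.adjugate * N) ^ k * X.adjugate * X = X.det • (X.adjugate * N) ^ k := by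
    rw [mul_assoc, Matrix.adjugate_mul, Matrix.mul_smul, mul_one]
  rw [mul_assoc X, h1, mul_assoc N, h2, mul_assoc X.adjugate, ← mul_assoc X, Matrix.mul_adjugate,
    Matrix.smul_mul, one_mul, Matrix.mul_smul]

/-- Right multiplication by `X` turns these elements into `det X` times the even powers of `adj X
N`. -/
theorem linearIndependent_kernelElement {p : ℕ} {N : So (2 * p + 1)} {X : Sym (2 * p + 1)}
    (hX : (X : Matrix (Fin (2 * p + 1)) (Fin (2 * p + 1)) ℝ).det ≠ 0)
    (hdistinct : (((X : Matrix (Fin (2 * p + 1)) (Fin (2 * p + 1)) ℝ).adjugate *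
      (N : Matrix (Fin (2 * p + 1)) (Fin (2 * p + 1)) ℝ)).map
        (algebraMap ℝ ℂ)).charpoly.roots.Nodup) :
    LinearIndependent ℝ fun j : Fin (p + 1) => kernelElement N X j := by
  let T : Sym (2 * p + 1) →ₗ[ℝ] Matrix (Fin (2 * p + 1)) (Fin (2 * p + 1)) ℝ :=
    (LinearMap.mulRight ℝ (X : Matrix (Fin (2 * p + 1)) (Fin (2 * p + 1)) ℝ)).comp
      (Sym (2 * p + 1)).subtype
  refine LinearIndependent.of_comp T ?_
  have hpow := (linearIndependent_pow_of_nodup hdistinct).comp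
    (fun j : Fin (p + 1) => (⟨2 * j, by omega⟩ : Fin (2 * p + 1)))
    (fun i j h => Fin.ext (by have := Fin.mk.inj_iff.1 h; omega))
  convert hpow.units_smul fun _ => Units.mk0 _ hX using 1
  funext j
  change ((X : Matrix (Fin (2 * p + 1)) (Fin (2 * p + 1)) ℝ).adjugate * _) ^ (2 * (j : ℕ)) * _ * _ = _
  rw [mul_assoc _ _ (X : Matrix (Fin (2 * p + 1)) (Fin (2 * p + 1)) ℝ), Matrix.adjugate_mul,
    Matrix.mul_smul, mul_one]
  rfl

theorem ker_poissonTensor {p : ℕ} {N : So (2 * p + 1)} {X : Sym (2 * p + 1)}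
    (hX : (X : Matrix (Fin (2 * p + 1)) (Fin (2 * p + 1)) ℝ).det ≠ 0)
    (hdistinct : (((X : Matrix (Fin (2 * p + 1)) (Fin (2 * p + 1)) ℝ).adjugate *
      (N : Matrix (Fin (2 * p + 1)) (Fin (2 * p + 1)) ℝ)).map
        (algebraMap ℝ ℂ)).charpoly.roots.Nodup) :
    LinearMap.ker (poissonTensor N X) =
      Submodule.span ℝ (Set.range fun j : Fin (p + 1) => kernelElement N X j) := by
  apply le_antisymm
  · intro Y hY
    set A := (X : Matrix (Fin (2 * p + 1)) (Fin (2 * p + 1)) ℝ) with hA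
    set M := (N : Matrix (Fin (2 * p + 1)) (Fin (2 * p + 1)) ℝ) with hM
    have hY' : A * (Y : Matrix _ _ ℝ) * M = M * (Y : Matrix _ _ ℝ) * A :=
      sub_eq_zero.1 (congrArg Subtype.val (LinearMap.mem_ker.1 hY))
    -- By `X Y N = N Y X` both products equal `det X • Y N`. Hence `Y X` is a polynomial in `adj X
    -- N`, and `det X • Y` is that polynomial times `adj X`.
    have hcomm : Commute ((Y : Matrix _ _ ℝ) * A) (A.adjugate * M) := by
      have h1 : (Y : Matrix _ _ ℝ) * A * (A.adjugate * M) = A.det • ((Y : Matrix _ _ ℝ) * M) := by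
        rw [mul_assoc, ← mul_assoc A, Matrix.mul_adjugate, Matrix.smul_mul, one_mul,
          Matrix.mul_smul]
      have h2 : A.adjugate * M * ((Y : Matrix _ _ ℝ) * A) = A.det • ((Y : Matrix _ _ ℝ) * M) := by
        rw [mul_assoc, ← mul_assoc M, ← hY', mul_assoc A, ← mul_assoc, Matrix.adjugate_mul,
          Matrix.smul_mul, one_mul]
      exact h1.trans h2.symm
    obtain ⟨c, hc⟩ := exists_sum_pow_of_commute hdistinct hcomm
    have hdet : A.det • (Y : Matrix _ _ ℝ) =
        ∑ i : Fin (2 * p + 1), c i • ((A.adjugate * M) ^ (i : ℕ) * A.adjugate) := by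
      have h1 : A.det • (Y : Matrix _ _ ℝ) = (Y : Matrix _ _ ℝ) * A * A.adjugate := by
        rw [mul_assoc, Matrix.mul_adjugate, Matrix.mul_smul, mul_one]
      rw [h1, hc, Finset.sum_mul]
      exact Finset.sum_congr rfl fun i _ => Matrix.smul_mul _ _ _
    have hsym : A.det • (Y : Matrix _ _ ℝ) =
        ∑ i : Fin (2 * p + 1), (c i * (-1) ^ (i : ℕ)) •
          ((A.adjugate * M) ^ (i : ℕ) * A.adjugate) := by
      have h1 := congrArg Matrix.transpose hdet
      rw [Matrix.transpose_smul, sym_transpose, Matrix.transpose_sum] at h1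
      rw [h1]
      refine Finset.sum_congr rfl fun i _ => ?_
      rw [Matrix.transpose_smul, hA, hM, pow_mul_adjugate_transpose, smul_smul]
    -- Averaging the expansion with its transpose kills the odd powers.
    have havg : (Y : Matrix _ _ ℝ) = ∑ i : Fin (2 * p + 1),
        ((2 * A.det)⁻¹ * (c i * (1 + (-1) ^ (i : ℕ)))) •
          ((A.adjugate * M) ^ (i : ℕ) * A.adjugate) := by
      have h2 : (2 * A.det) • (Y : Matrix _ _ ℝ) = ∑ i : Fin (2 * p + 1),
          (c i * (1 + (-1) ^ (i : ℕ))) • ((A.adjugate * M) ^ (i : ℕ) * A.adjugate) := by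
        rw [two_mul A.det, add_smul]
        nth_rewrite 1 [hdet]
        rw [hsym, ← Finset.sum_add_distrib]
        exact Finset.sum_congr rfl fun i _ => by rw [← add_smul, mul_add, mul_one]
      simp only [mul_smul _ (_ * _), ← Finset.smul_sum]
      rw [← h2, smul_smul, inv_mul_cancel₀ (mul_ne_zero two_ne_zero hX), one_smul]
    set e : ℕ → ℝ := fun i => if h : i < 2 * p + 1 then
      (2 * A.det)⁻¹ * (c ⟨i, h⟩ * (1 + (-1) ^ i)) else 0 with he
    have hYsum : Y = ∑ j : Fin (p + 1), e (2 * j) • kernelElement N X j := by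
      apply Subtype.ext
      rw [Submodule.coe_sum, havg]
      have h3 : ∀ i : Fin (2 * p + 1), (2 * A.det)⁻¹ * (c i * (1 + (-1) ^ (i : ℕ))) = e i :=
        fun i => by simp only [he, dif_pos i.2]
      simp only [h3]
      symm
      refine Finset.sum_of_injOn
        (fun j : Fin (p + 1) => (⟨2 * j, by omega⟩ : Fin (2 * p + 1)))
        (fun i _ j _ h => Fin.ext (by have := Fin.mk.inj_iff.1 h; omega))
        (fun _ _ => Finset.mem_coe.2 (Finset.mem_univ _)) (fun i _ hi => ?_) (fun j _ => rfl)
      rcases Nat.even_or_odd (i : ℕ) with hev | hodd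
      · obtain ⟨j, hj⟩ := hev
        exact absurd ⟨⟨j, by omega⟩, Finset.mem_coe.2 (Finset.mem_univ _),
          Fin.ext (by simp only; omega)⟩ hi
      · have : e i = 0 := by rw [← h3, hodd.neg_one_pow]; ring
        rw [this, zero_smul]
    rw [hYsum]
    exact Submodule.sum_mem _ fun j _ => Submodule.smul_mem _ _ (Submodule.subset_span ⟨j, rfl⟩)
  · rw [Submodule.span_le]
    rintro _ ⟨j, rfl⟩
    exact LinearMap.mem_ker.2 (Subtype.ext (sub_eq_zero.2 (mul_pow_mul_adjugate _ _ _)))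

theorem finrank_leafTangent {p : ℕ} {N : So (2 * p + 1)} {X : Sym (2 * p + 1)}
    (hX : (X : Matrix (Fin (2 * p + 1)) (Fin (2 * p + 1)) ℝ).det ≠ 0)
    (hdistinct : (((X : Matrix (Fin (2 * p + 1)) (Fin (2 * p + 1)) ℝ).adjugate *
      (N : Matrix (Fin (2 * p + 1)) (Fin (2 * p + 1)) ℝ)).map
        (algebraMap ℝ ℂ)).charpoly.roots.Nodup) :
    Module.finrank ℝ (leafTangent N X) = 2 * p * (p + 1) := by
  have h := LinearMap.finrank_range_add_finrank_ker (poissonTensor N X)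
  rw [ker_poissonTensor hX hdistinct,
    finrank_span_eq_card (linearIndependent_kernelElement hX hdistinct), Fintype.card_fin,
    finrank_sym] at h
  have h2 : (2 * p + 1 + 1).choose 2 = (2 * p + 1) * (p + 1) := by
    rw [Nat.choose_two_right]
    have : (2 * p + 1 + 1) * (2 * p + 1 + 1 - 1) = 2 * ((2 * p + 1) * (p + 1)) := by
      rw [Nat.add_sub_cancel]; ring
    rw [this, Nat.mul_div_cancel_left _ two_pos]
  rw [h2] at h
  rw [leafTangent]
  nlinarith

end Rank

/-! ### Independence on the leaf from independence of the pencil coefficients. -/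

section Independence

variable {n : ℕ}

/-- The pairs `(k, s)` with `s ≤ k ≤ n - 1`. -/
def pencilIndex (n : ℕ) : Finset (ℕ × ℕ) :=
  (Finset.range n ×ˢ Finset.range n).filter fun ks => ks.2 ≤ ks.1

theorem trace_mul_poissonTensor (N : So n) (X Y Z : Sym n) :
    ((Z : Matrix (Fin n) (Fin n) ℝ) * (poissonTensor N X Y : Matrix (Fin n) (Fin n) ℝ)).trace =
      -((poissonTensor N X Z : Matrix (Fin n) (Fin n) ℝ) * Y).trace := by
  simp only [poissonTensor, LinearMap.coe_mk, AddHom.coe_mk]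
  generalize (X : Matrix (Fin n) (Fin n) ℝ) = A
  generalize (Y : Matrix (Fin n) (Fin n) ℝ) = B
  generalize (Z : Matrix (Fin n) (Fin n) ℝ) = C
  generalize (N : Matrix (Fin n) (Fin n) ℝ) = M
  rw [mul_sub, sub_mul, Matrix.trace_sub, Matrix.trace_sub, neg_sub]
  congr 1
  · rw [← mul_assoc, Matrix.trace_mul_comm]; simp only [mul_assoc]
  · rw [← mul_assoc, Matrix.trace_mul_comm]; simp only [mul_assoc]

theorem independentOnLeafAt_integral {N : So n}
    (hdistinct : ((N : Matrix (Fin n) (Fin n) ℝ).map (algebraMap ℝ ℂ)).charpoly.roots.Nodup)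
    {X : Sym n} (h : LinearIndependent ℝ fun ks : pencilIndex n =>
      pencilCoeff (X : Matrix (Fin n) (Fin n) ℝ) N ks.1.1 ks.1.2) :
    IndependentOnLeafAt N (fun kr : integralIndex n => integral N kr.1.1 (2 * kr.1.2)) X := by
  rw [IndependentOnLeafAt, Fintype.linearIndependent_iff]
  intro c hc
  have hidx : ∀ kr : integralIndex n, kr.1.1 < n ∧ 1 ≤ kr.1.1 ∧ 2 * kr.1.2 < kr.1.1 := by
    intro kr
    have := kr.2
    simp only [integralIndex, Finset.mem_filter, Finset.mem_product, Finset.mem_range] at this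
    exact ⟨this.1.1, this.2⟩
  set G : Sym n := ∑ kr : integralIndex n, c kr • grad (integral N kr.1.1 (2 * kr.1.2)) X with hG
  -- `B_X` is skew for the trace form, so a combination of gradients that annihilates its range lies
  -- in its kernel.
  have hBG : poissonTensor N X G = 0 := by
    refine eq_zero_of_trace_mul _ fun Y => ?_
    rw [← neg_eq_zero, ← trace_mul_poissonTensor]
    have h1 := LinearMap.congr_fun hc ⟨poissonTensor N X Y, LinearMap.mem_range_self _ Y⟩
    simp only [LinearMap.sum_apply, LinearMap.smul_apply, LinearMap.comp_apply,
      Submodule.subtype_apply, ContinuousLinearMap.coe_coe, LinearMap.zero_apply,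
      smul_eq_mul] at h1
    rw [← h1, hG, Submodule.coe_sum, Finset.sum_mul, Matrix.trace_sum]
    refine Finset.sum_congr rfl fun kr _ => ?_
    rw [Submodule.coe_smul, Matrix.smul_mul, Matrix.trace_smul, trace_grad_mul, smul_eq_mul]
  set Z : Matrix (Fin n) (Fin n) ℝ := ∑ kr : integralIndex n,
    c kr • pencilCoeff (X : Matrix (Fin n) (Fin n) ℝ) N kr.1.1 (2 * kr.1.2) with hZ
  have hcomm : Commute Z (N : Matrix (Fin n) (Fin n) ℝ) := by
    rw [hG, map_sum] at hBG
    have h1 := congrArg Subtype.val hBG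
    rw [Submodule.coe_sum] at h1
    refine sub_eq_zero.1 (Eq.trans ?_ h1)
    rw [hZ, Finset.sum_mul, Finset.mul_sum, ← Finset.sum_sub_distrib]
    refine Finset.sum_congr rfl fun kr _ => ?_
    obtain ⟨k, hk⟩ : ∃ k, kr.1.1 = k + 1 := ⟨kr.1.1 - 1, by have := hidx kr; omega⟩
    rw [map_smul, Submodule.coe_smul, hk, poissonTensor_grad_integral, smul_sub, Matrix.smul_mul,
      Matrix.mul_smul]
  obtain ⟨d, hd⟩ := exists_sum_pow_of_commute hdistinct hcomm
  -- The relation compares the `P_{k,2r}` with the powers `N^j = P_{j,j}`. No index occurs twice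
  -- because `2r < k`.
  let σ : integralIndex n ⊕ Fin n → pencilIndex n := Sum.elim
    (fun kr => ⟨(kr.1.1, 2 * kr.1.2), by
      have := hidx kr
      simp only [pencilIndex, Finset.mem_filter, Finset.mem_product, Finset.mem_range]
      omega⟩)
    (fun j => ⟨(j, j), by simp [pencilIndex]⟩)
  have hσ : Function.Injective σ := by
    rintro (a | a) (b | b) hab
    · have h1 := congrArg Subtype.val hab
      simp only [σ, Sum.elim_inl, Prod.mk.injEq] at h1
      exact congrArg Sum.inl (Subtype.ext (Prod.ext h1.1 (by omega)))
    · have h1 := congrArg Subtype.val hab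
      simp only [σ, Sum.elim_inl, Sum.elim_inr, Prod.mk.injEq] at h1
      have := hidx a
      omega
    · have h1 := congrArg Subtype.val hab
      simp only [σ, Sum.elim_inl, Sum.elim_inr, Prod.mk.injEq] at h1
      have := hidx b
      omega
    · have h1 := congrArg Subtype.val hab
      simp only [σ, Sum.elim_inr, Prod.mk.injEq] at h1
      exact congrArg Sum.inr (Fin.ext h1.1)
  have hli := Fintype.linearIndependent_iff.1 (h.comp σ hσ) (Sum.elim c fun j => -d j) (by
    rw [Fintype.sum_sum_type]
    simp only [Sum.elim_inl, Sum.elim_inr, Function.comp_apply, σ, pencilCoeff_self, neg_smul,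
      Finset.sum_neg_distrib]
    rw [← hZ, hd, add_neg_cancel])
  exact fun kr => hli (Sum.inl kr)

end Independence

/-! ### Linear independence for a weighted shift and a diagonal matrix. -/

section Bidiagonal

variable {n : ℕ}

/-- Each factor `S` moves one superdiagonal up and each diagonal factor stays put, so a word with `k
- s` letters `S` lives on the superdiagonal `k - s`. -/
theorem pencilCoeff_shift_apply {S : Matrix (Fin n) (Fin n) ℂ} {ν : Fin n → ℂ}
    (hS : ∀ i j : Fin n, (j : ℕ) ≠ i + 1 → S i j = 0) (k s : ℕ) (i j : Fin n)
    (hij : (j : ℕ) + s ≠ i + k) : pencilCoeff S (Matrix.diagonal ν) k s i j = 0 := by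
  induction k generalizing s j with
  | zero =>
    rw [pencilCoeff_zero]
    split_ifs with hs
    · exact Matrix.one_apply_ne fun h => hij (by subst h; omega)
    · rfl
  | succ k ih =>
    have h1 : ∀ s, (j : ℕ) + s ≠ i + (k + 1) →
        (pencilCoeff S (Matrix.diagonal ν) k s * S) i j = 0 := by
      intro s hs
      rw [Matrix.mul_apply]
      refine Finset.sum_eq_zero fun l _ => ?_
      by_cases hl : (j : ℕ) = l + 1
      · rw [ih s l (by omega), zero_mul]
      · rw [hS l j hl, mul_zero]
    cases s with
    | zero => rw [pencilCoeff_succ_zero, h1 0 hij]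
    | succ s =>
      rw [pencilCoeff_succ_succ, Matrix.add_apply, h1 _ hij, Matrix.mul_diagonal, ih s j (by omega),
        zero_mul, add_zero]

theorem bidiagonal_pow_apply {S : Matrix (Fin n) (Fin n) ℂ} {ν : Fin n → ℂ}
    (hS : ∀ i j : Fin n, (j : ℕ) ≠ i + 1 → S i j = 0) (k m : ℕ) (i j : Fin n)
    (hij : (j : ℕ) = i + m) : ((S + Matrix.diagonal ν) ^ k) i j =
      if m ≤ k then pencilCoeff S (Matrix.diagonal ν) k (k - m) i j else 0 := by
  have h := congrFun (congrFun (sum_pencilCoeff S (Matrix.diagonal ν) 1 k) i) j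
  simp only [one_smul, one_pow, Matrix.sum_apply] at h
  rw [h]
  split_ifs with hm
  · rw [Finset.sum_eq_single (k - m)]
    · intro s hs hsm
      rw [Finset.mem_range] at hs
      exact pencilCoeff_shift_apply hS _ _ _ _ (by omega)
    · intro hmem
      exact absurd (Finset.mem_range.2 (by omega)) hmem
  · refine Finset.sum_eq_zero fun s _ => pencilCoeff_shift_apply hS _ _ _ _ (by omega)

theorem shift_pow_apply_ne_zero {S : Matrix (Fin n) (Fin n) ℂ}
    (hS : ∀ i j : Fin n, (j : ℕ) ≠ i + 1 → S i j = 0)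
    (hS' : ∀ i j : Fin n, (j : ℕ) = i + 1 → S i j ≠ 0) (k : ℕ) (i j : Fin n)
    (hij : (j : ℕ) = i + k) : (S ^ k) i j ≠ 0 := by
  induction k generalizing j with
  | zero =>
    obtain rfl : i = j := Fin.ext (by omega)
    simp
  | succ k ih =>
    rw [pow_succ, Matrix.mul_apply, Finset.sum_eq_single (⟨i + k, by omega⟩ : Fin n)]
    · exact mul_ne_zero (ih _ rfl) (hS' _ _ (by simp only; omega))
    · intro l _ hl
      rw [hS l j fun h => hl (Fin.ext (by simp only; omega)), mul_zero]
    · exact fun h => absurd (Finset.mem_univ _) h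

/-- A polynomial of degree less than `n` in an upper bidiagonal matrix with distinct diagonal
entries has degree less than `m` if the `m`-th superdiagonal of its value vanishes. -/
theorem natDegree_lt_of_superdiagonal_eq_zero {S : Matrix (Fin n) (Fin n) ℂ} {ν : Fin n → ℂ}
    (hν : Function.Injective ν) (hS : ∀ i j : Fin n, (j : ℕ) ≠ i + 1 → S i j = 0)
    (hS' : ∀ i j : Fin n, (j : ℕ) = i + 1 → S i j ≠ 0) {f : Polynomial ℂ} {m : ℕ}
    (hdeg : f.natDegree < n)
    (hm : ∀ i j : Fin n, (j : ℕ) = i + m →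
      Polynomial.aeval (S + Matrix.diagonal ν) f i j = 0) :
    f = 0 ∨ f.natDegree < m := by
  set A := S + Matrix.diagonal ν with hA
  set F := Polynomial.aeval A f with hF
  have hcomm : F * A = A * F := by
    have h := (Commute.all f Polynomial.X).map (Polynomial.aeval A)
    rw [Polynomial.aeval_X] at h
    exact h.eq
  -- `F` commutes with `A`. Once one superdiagonal of `F` vanishes, the `S`-terms of the commutator
  -- drop out on the next one, leaving `(ν j - ν i) F i j = 0`.
  have hband : ∀ d, ∀ i j : Fin n, (j : ℕ) = i + (m + d) → F i j = 0 := by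
    intro d
    induction d with
    | zero => exact hm
    | succ d ih =>
      intro i j hij
      have h := congrFun (congrFun hcomm i) j
      rw [hA, mul_add, add_mul, Matrix.add_apply, Matrix.add_apply, Matrix.mul_diagonal,
        Matrix.diagonal_mul] at h
      have h1 : (F * S) i j = 0 := by
        rw [Matrix.mul_apply]
        refine Finset.sum_eq_zero fun l _ => ?_
        by_cases hl : (j : ℕ) = l + 1
        · rw [ih i l (by omega), zero_mul]
        · rw [hS l j hl, mul_zero]
      have h2 : (S * F) i j = 0 := by
        rw [Matrix.mul_apply]
        refine Finset.sum_eq_zero fun l _ => ?_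
        by_cases hl : (l : ℕ) = i + 1
        · rw [ih l j (by omega), mul_zero]
        · rw [hS i l hl, zero_mul]
      rw [h1, h2, zero_add, zero_add, mul_comm, ← sub_eq_zero, ← sub_mul] at h
      refine (mul_eq_zero.1 h).resolve_left (sub_ne_zero.2 fun he => ?_)
      have := hν he
      subst this
      omega
  by_contra hcon
  rw [not_or, not_lt] at hcon
  obtain ⟨hf0, hmd⟩ := hcon
  -- Only the top power of `A` reaches this entry, so it is the leading coefficient times a product
  -- of nonzero weights of `S`.
  have hval := hband (f.natDegree - m) ⟨0, by omega⟩ ⟨f.natDegree, hdeg⟩ (by simp only; omega)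
  rw [hF, Polynomial.aeval_eq_sum_range, Matrix.sum_apply,
    Finset.sum_eq_single f.natDegree] at hval
  · rw [Matrix.smul_apply, smul_eq_mul, hA, bidiagonal_pow_apply hS _ f.natDegree _ _ (by simp),
      if_pos le_rfl, Nat.sub_self] at hval
    refine (mul_ne_zero (Polynomial.leadingCoeff_ne_zero.2 hf0) ?_) hval
    have hp : ∀ k, pencilCoeff S (Matrix.diagonal ν) k 0 = S ^ k := by
      intro k
      induction k with
      | zero => simp [pencilCoeff_zero]
      | succ k ih => rw [pencilCoeff_succ_zero, ih, pow_succ]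
    rw [hp]
    exact shift_pow_apply_ne_zero hS hS' _ _ _ (by simp)
  · intro k hk hkd
    rw [Finset.mem_range] at hk
    rw [Matrix.smul_apply, hA, bidiagonal_pow_apply hS k f.natDegree _ _ (by simp),
      if_neg (by omega), smul_zero]
  · exact fun h => absurd (Finset.mem_range.2 (Nat.lt_succ_self _)) h

theorem mem_pencilIndex {k s : ℕ} : (k, s) ∈ pencilIndex n ↔ k < n ∧ s ≤ k := by
  simp only [pencilIndex, Finset.mem_filter, Finset.mem_product, Finset.mem_range]
  omega

/-- A relation splits by superdiagonals `m = k - s`. The part with fixed `m` is the `m`-th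
superdiagonal of `f(S + D)`, where `f` has only powers `x^k` with `k ≥ m`; its vanishing forces
degree below `m`, so `f = 0`. -/
theorem linearIndependent_pencilCoeff_shift {S : Matrix (Fin n) (Fin n) ℂ} {ν : Fin n → ℂ}
    (hν : Function.Injective ν) (hS : ∀ i j : Fin n, (j : ℕ) ≠ i + 1 → S i j = 0)
    (hS' : ∀ i j : Fin n, (j : ℕ) = i + 1 → S i j ≠ 0) :
    LinearIndependent ℂ fun ks : pencilIndex n =>
      pencilCoeff S (Matrix.diagonal ν) ks.1.1 ks.1.2 := by
  rw [Fintype.linearIndependent_iff]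
  intro c hc
  set e : ℕ × ℕ → ℂ := fun ks => if h : ks ∈ pencilIndex n then c ⟨ks, h⟩ else 0 with he
  have hec : ∀ ks : pencilIndex n, e ks = c ks := fun ks => by simp [he]
  have hsum : ∑ ks ∈ pencilIndex n, e ks • pencilCoeff S (Matrix.diagonal ν) ks.1 ks.2 = 0 := by
    rw [← hc, ← Finset.sum_coe_sort]
    exact Finset.sum_congr rfl fun ks _ => by rw [hec]
  rintro ⟨⟨k₀, s₀⟩, hks⟩
  obtain ⟨hk, hs⟩ := mem_pencilIndex.1 hks
  rw [← hec]
  set m := k₀ - s₀ with hm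
  set f : Polynomial ℂ := ∑ k ∈ Finset.range n,
    if m ≤ k then Polynomial.monomial k (e (k, k - m)) else 0 with hf
  have hcoeff : ∀ k, f.coeff k = if k < n ∧ m ≤ k then e (k, k - m) else 0 := by
    intro k
    rw [hf, Polynomial.finsetSum_coeff]
    by_cases hkn : k < n
    · rw [Finset.sum_eq_single k]
      · by_cases hmk : m ≤ k
        · rw [if_pos hmk, if_pos ⟨hkn, hmk⟩, Polynomial.coeff_monomial, if_pos rfl]
        · rw [if_neg hmk, if_neg fun h => hmk h.2, Polynomial.coeff_zero]
      · intro j _ hj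
        split_ifs
        · rw [Polynomial.coeff_monomial, if_neg hj]
        · simp
      · exact fun h => absurd (Finset.mem_range.2 hkn) h
    · rw [if_neg (by omega)]
      refine Finset.sum_eq_zero fun j hj => ?_
      rw [Finset.mem_range] at hj
      split_ifs
      · rw [Polynomial.coeff_monomial, if_neg (by omega)]
      · simp
  have hdeg : f.natDegree < n := by
    refine lt_of_le_of_lt ((Polynomial.natDegree_le_iff_coeff_eq_zero (n := n - 1)).2 ?_)
      (by omega)
    intro k hk
    rw [hcoeff, if_neg (by omega)]
  have hvan : ∀ i j : Fin n, (j : ℕ) = i + m →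
      Polynomial.aeval (S + Matrix.diagonal ν) f i j = 0 := by
    intro i j hij
    have h0 := congrFun (congrFun hsum i) j
    rw [Polynomial.aeval_eq_sum_range' hdeg, Matrix.sum_apply]
    rw [Matrix.sum_apply, Matrix.zero_apply] at h0
    rw [← h0, pencilIndex, Finset.sum_filter, Finset.sum_product]
    refine Finset.sum_congr rfl fun k hk => ?_
    rw [Finset.mem_range] at hk
    rw [Matrix.smul_apply, smul_eq_mul, hcoeff, bidiagonal_pow_apply hS k m i j hij]
    by_cases hmk : m ≤ k
    · rw [if_pos ⟨hk, hmk⟩, if_pos hmk, Finset.sum_eq_single (k - m), if_pos (Nat.sub_le k m),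
        Matrix.smul_apply, smul_eq_mul]
      · intro s _ hs
        simp only
        split_ifs
        · rw [Matrix.smul_apply, pencilCoeff_shift_apply hS _ _ _ _ (by omega), smul_zero]
        · rfl
      · exact fun h => absurd (Finset.mem_range.2 (by omega)) h
    · rw [if_neg hmk, mul_zero, Finset.sum_eq_zero]
      intro s _
      simp only
      split_ifs
      · rw [Matrix.smul_apply, pencilCoeff_shift_apply hS _ _ _ _ (by omega), smul_zero]
      · rfl
  have hf0 : f = 0 := by
    refine (natDegree_lt_of_superdiagonal_eq_zero hν hS hS' hdeg hvan).elim id fun h => ?_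
    ext k
    by_cases hkm : m ≤ k
    · rw [Polynomial.coeff_eq_zero_of_natDegree_lt (by omega), Polynomial.coeff_zero]
    · rw [hcoeff, if_neg (by omega), Polynomial.coeff_zero]
  have := hcoeff k₀
  rw [hf0, Polynomial.coeff_zero, if_pos (by omega), hm, Nat.sub_sub_self hs] at this
  exact this.symm

end Bidiagonal

/-! ### Existence of a generic point, first complex and then real. -/

section GenericPoint

variable {n : ℕ}

/-- A finite set of complex numbers that is stable under negation can be enumerated so that
negation reverses the enumeration. -/
theorem exists_enumeration_rev (s : Finset ℂ) (hs : ∀ z ∈ s, -z ∈ s) (hcard : s.card = n) :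
    ∃ ν : Fin n → ℂ, Function.Injective ν ∧ (∀ i, ν i ∈ s) ∧ ∀ i, ν i.rev = -ν i := by
  -- Negation reverses the lexicographic order, so the negated and reversed increasing enumeration
  -- is increasing as well; uniqueness does the rest.
  let φ : ℂ → ℝ ×ₗ ℝ := fun z => toLex (z.re, z.im)
  let ψ : ℝ ×ₗ ℝ → ℂ := fun x => ⟨(ofLex x).1, (ofLex x).2⟩
  have hψφ : ∀ z, ψ (φ z) = z := fun z => rfl
  have hφψ : ∀ x, φ (ψ x) = x := fun x => rfl
  have hφ : Function.Injective φ := fun a b h => by rw [← hψφ a, h, hψφ]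
  have hcard' : (s.image φ).card = n := by rw [Finset.card_image_of_injective _ hφ, hcard]
  let g := (s.image φ).orderEmbOfFin hcard'
  have hmem : ∀ x, x ∈ s.image φ ↔ ψ x ∈ s := by
    intro x
    rw [Finset.mem_image]
    exact ⟨fun ⟨z, hz, h⟩ => by rw [← h]; exact hz, fun h => ⟨ψ x, h, hφψ x⟩⟩
  have hg : ∀ i, g i ∈ s.image φ := Finset.orderEmbOfFin_mem _ hcard'
  have hrev : (fun i : Fin n => -g i.rev) = g := by
    refine Finset.orderEmbOfFin_unique hcard' (fun i => ?_) fun i j hij => ?_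
    · rw [hmem]
      exact hs _ ((hmem _).1 (hg i.rev))
    · exact neg_lt_neg (g.strictMono (Fin.rev_lt_rev.2 hij))
  refine ⟨fun i => ψ (g i), fun i j h => g.injective ?_, fun i => (hmem _).1 (hg i), fun i => ?_⟩
  · rw [← hφψ (g i), ← hφψ (g j)]
    exact congrArg φ h
  · have h := congrFun hrev i.rev
    simp only [Fin.rev_rev] at h
    change ψ (g i.rev) = -ψ (g i)
    rw [← h]
    rfl

/-- Conjugation to an eigenbasis takes `X = Qᵀ T Q` to `(Q Qᵀ) T`. Skewness of `B` forces `Q Qᵀ` to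
pair the eigenvalues `ν` and `-ν`, so it is antidiagonal in the chosen order and a symmetric `T` can
make the product a weighted shift. -/
theorem exists_complex_point {p : ℕ} {B : Matrix (Fin (2 * p + 1)) (Fin (2 * p + 1)) ℂ}
    (hB : Bᵀ = -B) (hdistinct : B.charpoly.roots.Nodup) :
    ∃ X : Matrix (Fin (2 * p + 1)) (Fin (2 * p + 1)) ℂ, Xᵀ = X ∧
      LinearIndependent ℂ fun ks : pencilIndex (2 * p + 1) => pencilCoeff X B ks.1.1 ks.1.2 := by
  have hcard : B.charpoly.roots.toFinset.card = 2 * p + 1 := by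
    rw [Multiset.toFinset_card_of_nodup hdistinct,
      ← (IsAlgClosed.splits B.charpoly).natDegree_eq_card_roots, Matrix.charpoly_natDegree_eq_dim,
      Fintype.card_fin]
  have hroot : ∀ z, z ∈ B.charpoly.roots.toFinset ↔ B.charpoly.eval z = 0 := fun z => by
    rw [Multiset.mem_toFinset, Polynomial.mem_roots B.charpoly_monic.ne_zero, Polynomial.IsRoot]
  obtain ⟨ν, hν, hνroot, hνrev⟩ := exists_enumeration_rev _ (fun z hz => by
    rw [hroot] at hz ⊢
    have h := congrArg (Polynomial.eval z) (charpoly_comp_neg_of_skew hB)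
    rwa [Polynomial.eval_comp, Polynomial.eval_neg, Polynomial.eval_neg, Polynomial.eval_X, hz,
      neg_zero] at h) hcard
  obtain ⟨P, hP, hBP⟩ := exists_diagonalization B hν fun i => (hroot _).1 (hνroot i)
  obtain ⟨Q, hQP, hPQ⟩ : ∃ Q, Q * P = 1 ∧ P * Q = 1 := by
    obtain ⟨u, rfl⟩ := hP
    exact ⟨↑u⁻¹, u.inv_mul, u.mul_inv⟩
  have hQB : Q * B = Matrix.diagonal ν * Q := by
    calc Q * B = Q * (B * P) * Q := by rw [mul_assoc, mul_assoc, hPQ, mul_one]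
      _ = _ := by rw [hBP, ← mul_assoc Q P, hQP, one_mul]
  have hBQ : B * Qᵀ = -(Qᵀ * Matrix.diagonal ν) := by
    have h := congrArg Matrix.transpose hQB
    rw [Matrix.transpose_mul, Matrix.transpose_mul, hB, Matrix.diagonal_transpose, neg_mul] at h
    rw [← h, neg_neg]
  set R := Q * Qᵀ with hR
  have hRD : Matrix.diagonal ν * R = -(R * Matrix.diagonal ν) := by
    rw [hR, ← mul_assoc, ← hQB, mul_assoc, hBQ, mul_neg, mul_assoc]
  have hR0 : ∀ i j, j ≠ i.rev → R i j = 0 := by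
    intro i j hij
    have h := congrFun (congrFun hRD i) j
    rw [Matrix.neg_apply, Matrix.diagonal_mul, Matrix.mul_diagonal, mul_comm, eq_neg_iff_add_eq_zero,
      ← mul_add] at h
    refine (mul_eq_zero.1 h).resolve_right fun h => hij (hν ?_)
    rw [hνrev, eq_neg_iff_add_eq_zero, add_comm, h]
  have hRinv : R * (Pᵀ * P) = 1 := by
    rw [hR, mul_assoc, ← mul_assoc Qᵀ, ← Matrix.transpose_mul, hPQ, Matrix.transpose_one, one_mul,
      hQP]
  have hR1 : ∀ i, R i i.rev ≠ 0 := by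
    intro i hi
    have h := congrFun (congrFun hRinv i) i
    rw [Matrix.mul_apply, Matrix.one_apply_eq, Finset.sum_eq_zero] at h
    · exact zero_ne_one h
    · intro j _
      by_cases hj : j = i.rev
      · rw [hj, hi, zero_mul]
      · rw [hR0 i j hj, zero_mul]
  -- The ones lie next to the main antidiagonal `i + j = 2p`; this offset becomes the superdiagonal
  -- of `R * T`.
  set T : Matrix (Fin (2 * p + 1)) (Fin (2 * p + 1)) ℂ :=
    Matrix.of fun i j => if (i : ℕ) + j = 2 * p + 1 then 1 else 0 with hT
  have hTt : Tᵀ = T := by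
    ext i j
    simp [hT, add_comm]
  have hS : ∀ i j, (R * T) i j = if (j : ℕ) = i + 1 then R i i.rev else 0 := by
    intro i j
    rw [Matrix.mul_apply, Finset.sum_eq_single i.rev]
    · rw [hT, Matrix.of_apply, Fin.val_rev]
      have := i.2
      by_cases hj : (j : ℕ) = i + 1
      · rw [if_pos hj, if_pos (by omega), mul_one]
      · rw [if_neg hj, if_neg (by omega), mul_zero]
    · exact fun l _ hl => by rw [hR0 i l hl, zero_mul]
    · exact fun h => absurd (Finset.mem_univ _) h
  refine ⟨Qᵀ * T * Q, ?_, ?_⟩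
  · rw [Matrix.transpose_mul, Matrix.transpose_mul, Matrix.transpose_transpose, hTt, mul_assoc]
  · have hli := linearIndependent_pencilCoeff_shift (S := R * T) hν
      (fun i j hij => by rw [hS, if_neg hij]) (fun i j hij => by rw [hS, if_pos hij]; exact hR1 i)
    refine LinearIndependent.of_comp
      ((LinearMap.mulRight ℂ P).comp (LinearMap.mulLeft ℂ Q)) ?_
    have h1 : Q * (Qᵀ * T * Q) * P = R * T := by
      rw [hR]
      calc Q * (Qᵀ * T * Q) * P = Q * Qᵀ * T * (Q * P) := by simp only [mul_assoc]
        _ = _ := by rw [hQP, mul_one]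
    have h2 : Q * B * P = Matrix.diagonal ν := by rw [hQB, mul_assoc, hQP, mul_one]
    rw [← h1, ← h2] at hli
    simp only [pencilCoeff_conj _ _ hPQ] at hli
    exact hli

/-- The determinant of the values of the linear functionals with coefficients `R i` at the matrices
`pencilCoeff X N k s`, as a polynomial in the entries of `X`. -/
def independencePoly {K : Type*} [Field K] (N : Matrix (Fin n) (Fin n) K)
    (R : pencilIndex n → Matrix (Fin n) (Fin n) K) : MvPolynomial (Fin n × Fin n) K :=
  Matrix.det (Matrix.of fun i j : pencilIndex n =>
    ∑ a, ∑ b, MvPolynomial.C (R i a b) * pencilPoly N j.1.1 j.1.2 a b)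

theorem eval_independencePoly {K : Type*} [Field K] (N X : Matrix (Fin n) (Fin n) K)
    (R : pencilIndex n → Matrix (Fin n) (Fin n) K) :
    MvPolynomial.eval (entries X) (independencePoly N R) =
      Matrix.det (Matrix.of fun i j : pencilIndex n =>
        ∑ a, ∑ b, R i a b * pencilCoeff X N j.1.1 j.1.2 a b) := by
  rw [independencePoly, RingHom.map_det]
  congr 1
  ext i j
  simp only [RingHom.mapMatrix_apply, Matrix.map_apply, Matrix.of_apply, map_sum, map_mul,
    MvPolynomial.eval_C, ← pencilPoly_map_eval]

theorem linearIndependent_of_eval_ne_zero {K : Type*} [Field K] {N X : Matrix (Fin n) (Fin n) K}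
    {R : pencilIndex n → Matrix (Fin n) (Fin n) K}
    (h : MvPolynomial.eval (entries X) (independencePoly N R) ≠ 0) :
    LinearIndependent K fun ks : pencilIndex n => pencilCoeff X N ks.1.1 ks.1.2 := by
  rw [eval_independencePoly] at h
  rw [Fintype.linearIndependent_iff]
  intro c hc
  by_contra! hne
  refine h (Matrix.exists_mulVec_eq_zero_iff.1 ⟨c, fun h0 => ?_, ?_⟩)
  · obtain ⟨i, hi⟩ := hne
    exact hi (congrFun h0 i)
  · funext i
    have h1 : ∀ a b, ∑ j, c j * pencilCoeff X N j.1.1 j.1.2 a b = 0 := by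
      intro a b
      have := congrFun (congrFun hc a) b
      simpa only [Matrix.sum_apply, Matrix.smul_apply, smul_eq_mul, Matrix.zero_apply] using this
    have h2 : ∑ a, ∑ b, R i a b * ∑ j, c j * pencilCoeff X N j.1.1 j.1.2 a b = 0 := by
      simp only [h1, mul_zero, Finset.sum_const_zero]
    rw [Pi.zero_apply, ← h2, Matrix.mulVec, dotProduct]
    simp only [Matrix.of_apply, Finset.sum_mul, Finset.mul_sum]
    rw [Finset.sum_comm]
    refine Finset.sum_congr rfl fun a _ => ?_
    rw [Finset.sum_comm]
    exact Finset.sum_congr rfl fun b _ => Finset.sum_congr rfl fun j _ => by ring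

/-- The coordinates of a left inverse of the linear combination map serve as functionals; the
resulting matrix is the identity. -/
theorem exists_eval_independencePoly_ne_zero {K : Type*} [Field K]
    {N X : Matrix (Fin n) (Fin n) K}
    (h : LinearIndependent K fun ks : pencilIndex n => pencilCoeff X N ks.1.1 ks.1.2) :
    ∃ R, MvPolynomial.eval (entries X) (independencePoly N R) ≠ 0 := by
  obtain ⟨g, hg⟩ := LinearMap.exists_leftInverse_of_injective
    (Fintype.linearCombination K fun ks : pencilIndex n => pencilCoeff X N ks.1.1 ks.1.2)
    (LinearMap.ker_eq_bot.2 h.fintypeLinearCombination_injective)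
  refine ⟨fun i => Matrix.of fun a b => g (Matrix.single a b 1) i, ?_⟩
  rw [eval_independencePoly]
  refine ne_of_eq_of_ne (Eq.trans (congrArg Matrix.det ?_)
    (Matrix.det_one (n := pencilIndex n))) one_ne_zero
  ext i j
  have h1 := congrFun (LinearMap.congr_fun hg (Pi.single j 1)) i
  simp only [LinearMap.comp_apply, Fintype.linearCombination_apply_single, one_smul,
    LinearMap.id_apply] at h1
  rw [Matrix.matrix_eq_sum_single (pencilCoeff X N j.1.1 j.1.2)] at h1
  have h3 : (1 : Matrix (pencilIndex n) (pencilIndex n) K) i j = (Pi.single j 1 : _ → K) i := by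
    rw [Matrix.one_apply, Pi.single_apply]
  rw [h3, ← h1]
  simp only [map_sum, Finset.sum_apply, Matrix.of_apply]
  refine Finset.sum_congr rfl fun a _ => Finset.sum_congr rfl fun b _ => ?_
  have h2 : Matrix.single a b (pencilCoeff X N j.1.1 j.1.2 a b) =
      pencilCoeff X N j.1.1 j.1.2 a b • Matrix.single a b (1 : K) := by
    rw [Matrix.smul_single, smul_eq_mul, mul_one]
  rw [h2, map_smul, Pi.smul_apply, smul_eq_mul, mul_comm]

theorem exists_polynomial_line {K : Type*} [Field K] (q : MvPolynomial (Fin n × Fin n) K)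
    (A B : Matrix (Fin n) (Fin n) K) :
    ∃ g : Polynomial K, ∀ t, g.eval t = MvPolynomial.eval (entries (A + t • B)) q := by
  refine ⟨MvPolynomial.aeval (fun ij => Polynomial.C (A ij.1 ij.2) +
    Polynomial.X * Polynomial.C (B ij.1 ij.2)) q, fun t => ?_⟩
  induction q using MvPolynomial.induction_on with
  | C a => simp
  | add p q hp hq => rw [map_add, map_add, Polynomial.eval_add, hp, hq]
  | mul_X p ij hp =>
    rw [map_mul, map_mul, Polynomial.eval_mul, hp, MvPolynomial.aeval_X, MvPolynomial.eval_X]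
    simp [entries, mul_comm t]

/-- Split the complex witness as `Z = A + iB`. On the line `A + tB` the independence determinant is
a polynomial in `t` that is nonzero at `t = i`, hence at some real `t`. -/
theorem exists_real_point {p : ℕ} (N : So (2 * p + 1))
    (hdistinct : ((N : Matrix (Fin (2 * p + 1)) (Fin (2 * p + 1)) ℝ).map
      (algebraMap ℝ ℂ)).charpoly.roots.Nodup) :
    ∃ X : Sym (2 * p + 1), LinearIndependent ℝ fun ks : pencilIndex (2 * p + 1) =>
      pencilCoeff (X : Matrix (Fin (2 * p + 1)) (Fin (2 * p + 1)) ℝ) N ks.1.1 ks.1.2 := by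
  obtain ⟨Z, hZ, hli⟩ := exists_complex_point
    (B := (N : Matrix (Fin (2 * p + 1)) (Fin (2 * p + 1)) ℝ).map (algebraMap ℝ ℂ)) (by
      rw [← Matrix.transpose_map, so_transpose]
      ext i j
      simp) hdistinct
  obtain ⟨R, hR⟩ := exists_eval_independencePoly_ne_zero hli
  have hZs : ∀ i j, Z j i = Z i j := fun i j => congrFun (congrFun hZ i) j
  let A : Sym (2 * p + 1) := ⟨Z.map Complex.re, by
    change Matrix.IsSymm _
    ext i j
    simp [hZs i j]⟩
  let B : Sym (2 * p + 1) := ⟨Z.map Complex.im, by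
    change Matrix.IsSymm _
    ext i j
    simp [hZs i j]⟩
  obtain ⟨g, hg⟩ := exists_polynomial_line (independencePoly
    ((N : Matrix (Fin (2 * p + 1)) (Fin (2 * p + 1)) ℝ).map (algebraMap ℝ ℂ)) R)
    ((A : Matrix (Fin (2 * p + 1)) (Fin (2 * p + 1)) ℝ).map (algebraMap ℝ ℂ))
    ((B : Matrix (Fin (2 * p + 1)) (Fin (2 * p + 1)) ℝ).map (algebraMap ℝ ℂ))
  have hZAB : (A : Matrix (Fin (2 * p + 1)) (Fin (2 * p + 1)) ℝ).map (algebraMap ℝ ℂ) +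
      Complex.I • (B : Matrix (Fin (2 * p + 1)) (Fin (2 * p + 1)) ℝ).map (algebraMap ℝ ℂ) = Z := by
    ext i j
    simp only [Matrix.add_apply, Matrix.smul_apply, Matrix.map_apply, smul_eq_mul, A, B,
      Complex.coe_algebraMap]
    rw [mul_comm, Complex.re_add_im]
  have hg0 : g ≠ 0 := by
    intro h0
    have h1 := hg Complex.I
    rw [hZAB, h0, Polynomial.eval_zero] at h1
    exact hR h1.symm
  obtain ⟨t, ht⟩ : ∃ t : ℝ, g.eval (t : ℂ) ≠ 0 := by
    by_contra! hall
    refine hg0 (Polynomial.eq_zero_of_infinite_isRoot g (Set.Infinite.mono ?_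
      (Set.infinite_range_of_injective Complex.ofReal_injective)))
    rintro _ ⟨t, rfl⟩
    exact hall t
  refine ⟨A + t • B, ?_⟩
  rw [hg] at ht
  have h1 := linearIndependent_of_eval_ne_zero ht
  have h2 : (A : Matrix (Fin (2 * p + 1)) (Fin (2 * p + 1)) ℝ).map (algebraMap ℝ ℂ) +
      (t : ℂ) • (B : Matrix (Fin (2 * p + 1)) (Fin (2 * p + 1)) ℝ).map (algebraMap ℝ ℂ) =
      ((A + t • B : Sym (2 * p + 1)) : Matrix (Fin (2 * p + 1)) (Fin (2 * p + 1)) ℝ).map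
        (algebraMap ℝ ℂ) := by
    ext i j
    simp
  rw [h2, Fintype.linearIndependent_iff] at h1
  simp only [pencilCoeff_map] at h1
  rw [Fintype.linearIndependent_iff]
  intro c hc ks
  have h3 := h1 (fun ks => (c ks : ℂ)) (by
    ext i j
    have h4 := congrArg (algebraMap ℝ ℂ) (congrFun (congrFun hc i) j)
    simp only [Matrix.sum_apply, Matrix.smul_apply, smul_eq_mul, map_sum, map_mul,
      Matrix.zero_apply, map_zero] at h4
    simp only [Matrix.sum_apply, Matrix.smul_apply, smul_eq_mul, Matrix.map_apply,
      Matrix.zero_apply]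
    exact h4) ks
  exact_mod_cast h3

/-- A polynomial in the entries of `X` which vanishes unless `X` is invertible and `adj X N` has
distinct eigenvalues. -/
def regularPoly (N : Matrix (Fin n) (Fin n) ℝ) : MvPolynomial (Fin n × Fin n) ℝ :=
  (Matrix.mvPolynomialX (Fin n) (Fin n) ℝ).det *
    (hankel ((Matrix.mvPolynomialX (Fin n) (Fin n) ℝ).adjugate * N.map MvPolynomial.C)).det

theorem eval_regularPoly (N X : Matrix (Fin n) (Fin n) ℝ) :
    MvPolynomial.eval (entries X) (regularPoly N) = X.det * (hankel (X.adjugate * N)).det := by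
  rw [regularPoly, map_mul, RingHom.map_det, RingHom.map_det, RingHom.mapMatrix_apply,
    RingHom.mapMatrix_apply, map_eval_mvPolynomialX, ← hankel_map, Matrix.map_mul,
    ← RingHom.mapMatrix_apply, RingHom.map_adjugate, RingHom.mapMatrix_apply,
    map_eval_mvPolynomialX, map_eval_map_C]

theorem regular_of_eval_ne_zero {N X : Matrix (Fin n) (Fin n) ℝ}
    (h : MvPolynomial.eval (entries X) (regularPoly N) ≠ 0) :
    X.det ≠ 0 ∧ ((X.adjugate * N).map (algebraMap ℝ ℂ)).charpoly.roots.Nodup := by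
  rw [eval_regularPoly] at h
  refine ⟨left_ne_zero_of_mul h, nodup_roots_of_det_hankel_ne_zero ?_⟩
  rw [hankel_map, ← RingHom.mapMatrix_apply, ← RingHom.map_det]
  exact (map_ne_zero _).2 (right_ne_zero_of_mul h)

theorem eval_one_regularPoly_ne_zero {N : Matrix (Fin n) (Fin n) ℝ} (hN : Nᵀ = -N)
    (hdistinct : (N.map (algebraMap ℝ ℂ)).charpoly.roots.Nodup) :
    MvPolynomial.eval (entries (1 : Matrix (Fin n) (Fin n) ℝ)) (regularPoly N) ≠ 0 := by
  rw [eval_regularPoly, Matrix.det_one, Matrix.adjugate_one, one_mul, one_mul]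
  exact det_hankel_ne_zero_of_skew hN hdistinct

/-- The line through `X` and `Y` stays in `Sym(n)`; on it both restrictions are nonzero polynomials
in one variable. -/
theorem exists_eval_mul_ne_zero {q r : MvPolynomial (Fin n × Fin n) ℝ} {X Y : Sym n}
    (hq : MvPolynomial.eval (entries (X : Matrix (Fin n) (Fin n) ℝ)) q ≠ 0)
    (hr : MvPolynomial.eval (entries (Y : Matrix (Fin n) (Fin n) ℝ)) r ≠ 0) :
    ∃ Z : Sym n, MvPolynomial.eval (entries (Z : Matrix (Fin n) (Fin n) ℝ)) (q * r) ≠ 0 := by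
  obtain ⟨f, hf⟩ := exists_polynomial_line q (X : Matrix (Fin n) (Fin n) ℝ)
    ((Y - X : Sym n) : Matrix (Fin n) (Fin n) ℝ)
  obtain ⟨g, hg⟩ := exists_polynomial_line r (X : Matrix (Fin n) (Fin n) ℝ)
    ((Y - X : Sym n) : Matrix (Fin n) (Fin n) ℝ)
  have hf0 : f ≠ 0 := by
    rintro rfl
    have h := hf 0
    rw [zero_smul, add_zero, Polynomial.eval_zero] at h
    exact hq h.symm
  have hg0 : g ≠ 0 := by
    rintro rfl
    have h := hg 1
    rw [one_smul, Submodule.coe_sub, add_sub_cancel, Polynomial.eval_zero] at h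
    exact hr h.symm
  by_contra! hall
  refine mul_ne_zero hf0 hg0 (Polynomial.funext fun t => ?_)
  rw [Polynomial.eval_mul, hf, hg, ← map_mul, Polynomial.eval_zero]
  exact hall (X + t • (Y - X))

end GenericPoint

/-! ### Counting the integrals, and assembly. -/

theorem card_integralIndex (p : ℕ) :
    2 * Fintype.card (integralIndex (2 * p + 1)) = 2 * p * (p + 1) := by
  have h : ∀ n, (integralIndex n).card = ∑ k ∈ Finset.range n, (k + 1) / 2 := by
    intro n
    rw [integralIndex, Finset.card_filter, Finset.sum_product]
    refine Finset.sum_congr rfl fun k hk => ?_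
    rw [Finset.mem_range] at hk
    rw [← Finset.card_filter]
    have h1 : (Finset.range n).filter (fun r => 1 ≤ k ∧ 2 * r < k) = Finset.range ((k + 1) / 2) := by
      ext r
      simp only [Finset.mem_filter, Finset.mem_range]
      omega
    rw [h1, Finset.card_range]
  rw [Fintype.card_coe, h]
  induction p with
  | zero => simp
  | succ p ih =>
    rw [show 2 * (p + 1) + 1 = 2 * p + 1 + 1 + 1 by ring, Finset.sum_range_succ,
      Finset.sum_range_succ, mul_add, mul_add, ih, show (2 * p + 1 + 1) / 2 = p + 1 by omega,
      show (2 * p + 1 + 1 + 1) / 2 = p + 1 by omega]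
    ring

/-- The exceptional set is cut out by `regularPoly N * independencePoly N R`. The first factor fixes
the rank on the whole leaf through the Casimirs; the nonvanishing locus of the second is the open
set `V`. -/
theorem generic_leaf {p : ℕ} (N : So (2 * p + 1))
    (hdistinct : ((N : Matrix (Fin (2 * p + 1)) (Fin (2 * p + 1)) ℝ).map
      (algebraMap ℝ ℂ)).charpoly.roots.Nodup) :
    Generically fun X₀ : Sym (2 * p + 1) =>
      (∀ X ∈ leaf N X₀, Module.finrank ℝ (leafTangent N X) = 2 * p * (p + 1)) ∧
      ∃ V : Set (Sym (2 * p + 1)), IsOpen V ∧ leaf N X₀ ⊆ closure (leaf N X₀ ∩ V) ∧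
        ∀ X ∈ leaf N X₀ ∩ V, IndependentOnLeafAt N
          (fun kr : integralIndex (2 * p + 1) => integral N kr.1.1 (2 * kr.1.2)) X := by
  obtain ⟨Y, hY⟩ := exists_real_point N hdistinct
  obtain ⟨R, hR⟩ := exists_eval_independencePoly_ne_zero hY
  have hone := eval_one_regularPoly_ne_zero (so_transpose N) hdistinct
  have hex := exists_eval_mul_ne_zero (X := ⟨1, Matrix.isSymm_one⟩) hone hR
  refine ⟨_, hex, fun X₀ hX₀' => ?_⟩
  have hX₀ : MvPolynomial.eval (entries (X₀ : Matrix (Fin (2 * p + 1)) (Fin (2 * p + 1)) ℝ))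
      (regularPoly N * independencePoly N R) ≠ 0 := hX₀'
  rw [map_mul] at hX₀
  obtain ⟨hdet, hnodup⟩ := regular_of_eval_ne_zero (left_ne_zero_of_mul hX₀)
  refine ⟨fun X hX => ?_, _, ?_, leaf_subset_closure (right_ne_zero_of_mul hX₀), fun X hX => ?_⟩
  · obtain ⟨hdetX, hchar⟩ := charpoly_eq_of_mem_leaf hX hdet
    refine finrank_leafTangent hdetX ?_
    rw [Matrix.charpoly_map] at hnodup ⊢
    rwa [hchar]
  · exact isOpen_ne_fun (contDiff_eval _).continuous continuous_const
  · exact independentOnLeafAt_integral hdistinct (linearIndependent_of_eval_ne_zero hX.2)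

theorem exists_succ_of_mem_integralIndex {n : ℕ} (kr : integralIndex n) :
    ∃ k, kr.1.1 = k + 1 := by
  have h := kr.2
  simp only [integralIndex, Finset.mem_filter] at h
  exact ⟨kr.1.1 - 1, by omega⟩

end SymFlow

end

theorem mainTheorem3 (p : ℕ) (N : SymFlow.So (2 * p + 1))
    (hdistinct : ((N : Matrix (Fin (2 * p + 1)) (Fin (2 * p + 1)) ℝ).map
      (algebraMap ℝ ℂ)).charpoly.roots.Nodup)
    (hnullity : Module.finrank ℝ (LinearMap.ker (Matrix.toLin'
      (N : Matrix (Fin (2 * p + 1)) (Fin (2 * p + 1)) ℝ))) = 1) :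
    SymFlow.IsCompletelyIntegrable N (SymFlow.flowField N) SymFlow.energy
      (fun kr : SymFlow.integralIndex (2 * p + 1) =>
        SymFlow.integral N kr.1.1 (2 * kr.1.2))
      (2 * p * (p + 1)) ∧
    ∃ w : Polynomial ℝ, w.natDegree = p ∧
      minpoly ℝ (N : Matrix (Fin (2 * p + 1)) (Fin (2 * p + 1)) ℝ) =
        Polynomial.X * w.comp (Polynomial.X ^ 2) := by
  refine ⟨⟨?_, SymFlow.flowField_eq N, fun kr => SymFlow.contDiff_integral N _ _, fun kr X => ?_,
    fun kr ls X => ?_, SymFlow.card_integralIndex p, SymFlow.generic_leaf N hdistinct⟩,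
    SymFlow.exists_minpoly_eq (SymFlow.so_transpose N) hdistinct⟩
  · rw [SymFlow.energy_eq_integral N]
    exact SymFlow.contDiff_integral N _ _
  · obtain ⟨k, hk⟩ := SymFlow.exists_succ_of_mem_integralIndex kr
    rw [SymFlow.energy_eq_integral N, hk]
    exact SymFlow.liePoisson_integral N _ _ _ _ X
  · obtain ⟨k, hk⟩ := SymFlow.exists_succ_of_mem_integralIndex kr
    obtain ⟨l, hl⟩ := SymFlow.exists_succ_of_mem_integralIndex ls
    rw [hk, hl]
    exact SymFlow.liePoisson_integral N _ _ _ _ X
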